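/- Let $d\in\mathbb N$ and let $$P(\partial_t,D_x)=\partial_t^m+\sum_{k=1}^m a_k(D_x)\,\partial_t^{m-k},\qquad m\ge 1,$$ where $a_1,\dots,a_m$ are arbitrary complex polynomials on $\mathbb R^d$ and $D_{x_j}=\frac1{2\pi i}\partial_{x_j}$; write $P(\lambda,\zeta)=\lambda^m+\sum_{k=1}^m a_k(\zeta)\lambda^{m-k}$ for $(\lambda,\zeta)\in\mathbb C\times\mathbb C^d$. Suppose that for some $\nu\ge1$ and $C_0>0$ $$(\tau,\zeta)\in\mathbb C\times\mathbb C^d,\quad P(i\tau,\zeta)=0\ \Longrightarrow\ \operatorname{Im}\tau\ \ge\ -C_0\,(1+|\operatorname{Im}\zeta|)^{\nu}.$$ For $\xi\in\mathbb R^d$ let $\sigma(\cdot,\xi)$ be the unique solution, supported in $[0,\infty)$, of $\big(\partial_t^m+\sum_{k=1}^m a_k(\xi)\partial_t^{m-k}\big)\sigma(t,\xi)=\delta(t)$ in the sense of distributions on $\mathbb R$; it is a function of $t$, and we take its representative that is continuous on $[0,\infty)$ and zero for $t<0$. With $\hat f(\xi)=\mathcal Ff(\xi)=\int_{\mathbb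 R^d} f(x)e^{-2\pi i x\cdot\xi}\,dx$, let $\sigma(t,D_x)f=\mathcal F^{-1}(\sigma(t,\cdot)\hat f)$. For $z=(x,\xi)\in\mathbb R^{2d}$ let $\pi(z)f(y)=e^{2\pi i\xi\cdot y}f(y-x)$, and let $\langle f,h\rangle=\int_{\mathbb R^d} f\,\overline{h}\,dx$. Set $r=\min\{2,\nu/(\nu-1)\}$ (so $r=2$ if $\nu=1$). Let $g\in S^{1/r}_{1/r}(\mathbb R^d)$; that is, $g$ is a Schwartz function and there are $A,B>0$ and $C_1>0$ with $$|x^\alpha\partial^\beta g(x)|\le C_1A^{|\alpha|}B^{|\beta|}(\alpha!)^{1/r}(\beta!)^{1/r}\qquad\text{for all } x\in\mathbb R^d,\ \alpha,\beta\in\mathbb N^d.$$ Then for every bounded set $T\subset[0,\infty)$ there are $\varepsilon>0$ and $C>0$ such that for all $t\in T$ and all $z,w\in\mathbb R^{2d}$ the integrals defining $\sigma(t,D_x)\pi(z)g$ and $\langle\sigma(t,D_x)\pi(z)g,\pi(w)g\rangle$ converge absolutely and $$|\langle\sigma(t,D_x)\pi(z)g,\pi(w)g\rangle|\le C\exp\big(-\varepsilon|w-z|^{r}\big).$$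 -/

import Mathlib

open MeasureTheory Set
open scoped ContDiff SchwartzMap FourierTransform LineDeriv

namespace GaborEvolution

/-- The Euclidean space `ℝ^d`. -/
abbrev E (d : ℕ) := EuclideanSpace ℝ (Fin d)

/-- The phase space `ℝ^{2d} = ℝ^d × ℝ^d` with its Euclidean norm; a point is `z = (z.fst, z.snd) =
(position, frequency)`. -/
abbrev Phase (d : ℕ) := WithLp 2 (E d × E d)

/-! ### Gelfand-Shilov spaces -/

/-- The partial derivative `∂^β f` of a Schwartz function, `β` a multi-index. -/
noncomputable def multiDeriv {d : ℕ} (β : Fin d → ℕ) (f : 𝓢(E d, ℂ)) : 𝓢(E d, ℂ) :=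
  (List.finRange d).foldr
    (fun i h => (fun k : 𝓢(E d, ℂ) => ∂_{EuclideanSpace.single i (1 : ℝ)} k)^[β i] h) f

/-- `f ∈ S^s_r(ℝ^d)`: there are `A, B > 0` with
`|x^α ∂^β f(x)| ≲ A^|α| B^|β| (α!)^r (β!)^s` for all multi-indices `α, β` and all `x`. -/
def GelfandShilov {d : ℕ} (s r : ℝ) (f : 𝓢(E d, ℂ)) : Prop :=
  ∃ A B C : ℝ, 0 < A ∧ 0 < B ∧ 0 < C ∧ ∀ (α β : Fin d → ℕ) (x : E d),
    |∏ i, x i ^ α i| * ‖multiDeriv β f x‖ ≤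
      C * (A ^ (∑ i, α i) * B ^ (∑ i, β i) *
        ((∏ i, (Nat.factorial (α i) : ℝ)) ^ r * (∏ i, (Nat.factorial (β i) : ℝ)) ^ s))

/-! ### Time-frequency shifts, Fourier multipliers, Gabor matrix -/

/-- The time-frequency shift `π(z) f (y) = e^{2πi ξ·y} f(y - x)` for `z = (x, ξ)`. -/
noncomputable def timeFreqShift {d : ℕ} (z : Phase d) (f : E d → ℂ) : E d → ℂ :=
  fun y => Complex.exp (2 * Real.pi * Complex.I * (inner ℝ z.snd y : ℝ)) * f (y - z.fst)

/-- The Fourier multiplier `σ(D_x) f = 𝓕⁻¹ (σ 𝓕 f)`, with `𝓕 f(ξ) = ∫ f(x) e^{-2πi x·ξ} dx`. -/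
noncomputable def fourierMultiplier {d : ℕ} (σ : E d → ℂ) (f : E d → ℂ) : E d → ℂ :=
  𝓕⁻ (fun ξ => σ ξ * 𝓕 f ξ)

/-- The bracket `⟨f, h⟩ = ∫ f(x) conj (h(x)) dx`. -/
noncomputable def bracket {d : ℕ} (f h : E d → ℂ) : ℂ :=
  ∫ x, f x * (starRingEnd ℂ) (h x)

/-! ### The forward fundamental solution of a constant-coefficient ODE -/

/-- The formal transpose of `∂_t^m + ∑_{k=1}^m c_k ∂_t^{m-k}` applied to `φ`. -/
noncomputable def transposeODE (m : ℕ) (c : ℕ → ℂ) (φ : ℝ → ℂ) (t : ℝ) : ℂ :=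
  (-1) ^ m * iteratedDeriv m φ t +
    ∑ k ∈ Finset.Icc 1 m, c k * ((-1) ^ (m - k) * iteratedDeriv (m - k) φ t)

/-- `u` is the solution of `(∂_t^m + ∑_{k=1}^m c_k ∂_t^{m-k}) u = δ(t)` supported in `[0, ∞)`: the
equation holds in the sense of distributions on `ℝ`, and `u` is the representative which is
continuous on `[0, ∞)` (so that its value at each `t ≥ 0` makes sense) and `0` for `t < 0`. -/
structure IsForwardFundamentalSolution (m : ℕ) (c : ℕ → ℂ) (u : ℝ → ℂ) : Prop where
  eq_zero_of_neg : ∀ t < 0, u t = 0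
  continuousOn : ContinuousOn u (Ici 0)
  weak_eq : ∀ φ : ℝ → ℂ, ContDiff ℝ ∞ φ → HasCompactSupport φ →
    ∫ t, u t * transposeODE m c φ t = φ 0

theorem exists_classical (m : ℕ) (hm : 0 < m) (c : ℕ → ℂ) :
    ∃ U : ℕ → ℝ → ℂ, (∀ i t, HasDerivAt (U i) (U (i + 1) t) t) ∧
      (∀ i, i + 1 < m → U i 0 = 0) ∧ U (m - 1) 0 = 1 ∧
      ∀ t, U m t + ∑ k ∈ Finset.Icc 1 m, c k * U (m - k) t = 0 := by
  let ext : (Fin m → ℂ) → ℕ → ℂ := fun y i => if h : i < m then y ⟨i, h⟩ else 0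
  let A₀ : (Fin m → ℂ) →ₗ[ℂ] (Fin m → ℂ) :=
    { toFun := fun y i => if i.1 + 1 < m then ext y (i.1 + 1)
        else - ∑ k ∈ Finset.Icc 1 m, c k * ext y (m - k)
      map_add' := by
        intro y z
        have hext : ∀ i, ext (y + z) i = ext y i + ext z i := by
          intro i; simp only [ext]; split_ifs <;> simp
        funext i
        simp only [hext, Pi.add_apply, mul_add, Finset.sum_add_distrib]
        split_ifs <;> ring
      map_smul' := by
        intro a y
        have hext : ∀ i, ext (a • y) i = a * ext y i := by
          intro i; simp only [ext]; split_ifs <;> simp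
        funext i
        simp only [hext, Pi.smul_apply, smul_eq_mul, RingHom.id_apply, mul_left_comm _ a,
          ← Finset.mul_sum]
        split_ifs <;> ring }
  let A : (Fin m → ℂ) →L[ℂ] (Fin m → ℂ) := LinearMap.toContinuousLinearMap A₀
  let e : Fin m → ℂ := Pi.single ⟨m - 1, by omega⟩ 1
  let ℓ : (Fin m → ℂ) →L[ℂ] ℂ := ContinuousLinearMap.proj ⟨0, hm⟩
  have hA : ∀ y i, A y i = if i.1 + 1 < m then ext y (i.1 + 1)
        else - ∑ k ∈ Finset.Icc 1 m, c k * ext y (m - k) := fun y i => rfl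
  have hpow : ∀ i (hi : i < m) y, ((A ^ i) y) ⟨0, hm⟩ = y ⟨i, hi⟩ := by
    intro i
    induction i with
    | zero => intro hi y; simp
    | succ i ih =>
      intro hi y
      rw [pow_succ, mul_apply_eq_comp, ih (by omega), hA]
      simp [hi, ext]
  have hexp : NormedSpace.exp ((0 : ℝ) • A) = 1 := by
    rw [zero_smul ℝ A]; exact NormedSpace.exp_zero
  refine ⟨fun i t => ℓ ((A ^ i) ((NormedSpace.exp (t • A)) e)), ?_, ?_, ?_, ?_⟩
  · intro i t
    have h1 := hasDerivAt_exp_smul_const' (𝕂 := ℝ) A t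
    let L : ((Fin m → ℂ) →L[ℂ] (Fin m → ℂ)) →L[ℝ] ℂ :=
      ((ℓ ∘L (A ^ i)).restrictScalars ℝ) ∘L
        ((ContinuousLinearMap.apply ℂ (Fin m → ℂ) e).restrictScalars ℝ)
    have h2 := L.hasFDerivAt.comp_hasDerivAt t h1
    have h3 : L (A * NormedSpace.exp (t • A)) = ℓ ((A ^ (i + 1)) ((NormedSpace.exp (t • A)) e)) := by
      rw [pow_succ]; rfl
    rw [h3] at h2
    exact h2
  · intro i hi
    simp only [ℓ, ContinuousLinearMap.proj_apply, hpow i (by omega)]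
    rw [hexp, one_apply_eq_self]
    simp only [e]
    rw [Pi.single_eq_of_ne]
    intro h
    have := congrArg Fin.val h
    simp at this
    omega
  · simp only [ℓ, ContinuousLinearMap.proj_apply, hpow (m - 1) (by omega)]
    rw [hexp, one_apply_eq_self]
    simp [e]
  · intro t
    simp only [ℓ, ContinuousLinearMap.proj_apply]
    generalize (NormedSpace.exp (t • A)) e = y
    have h1 : ((A ^ m) y) ⟨0, hm⟩ = - ∑ k ∈ Finset.Icc 1 m, c k * ext y (m - k) := by
      obtain ⟨n, rfl⟩ : ∃ n, m = n + 1 := ⟨m - 1, by omega⟩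
      rw [pow_succ, mul_apply_eq_comp, hpow n (by omega), hA]
      simp
    rw [h1, neg_add_eq_zero]
    refine Finset.sum_congr rfl fun k hk => ?_
    rw [Finset.mem_Icc] at hk
    rw [hpow (m - k) (by omega)]
    simp only [ext]
    rw [dif_pos]

theorem exists_isForwardFundamentalSolution {m : ℕ} (hm : 0 < m) (c : ℕ → ℂ) :
    ∃ u, IsForwardFundamentalSolution m c u := by
  obtain ⟨U, hU, h0, h1, hQ⟩ := exists_classical m hm c
  have hUc : ∀ i, Continuous (U i) := fun i =>
    continuous_iff_continuousAt.2 fun t => (hU i t).continuousAt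
  refine ⟨fun t => if t < 0 then 0 else U 0 t, fun t ht => if_pos ht, ?_, ?_⟩
  · refine (hUc 0).continuousOn.congr fun t ht => ?_
    exact if_neg (not_lt.2 ht)
  intro φ hφ hφc
  have hd : ∀ i t, HasDerivAt (iteratedDeriv i φ) (iteratedDeriv (i + 1) φ t) t := by
    intro i t
    rw [iteratedDeriv_succ]
    exact ((hφ.differentiable_iteratedDeriv i (by exact_mod_cast ENat.natCast_lt_top i)) t).hasDerivAt
  have hφd : ∀ i, Continuous (iteratedDeriv i φ) := fun i =>
    continuous_iff_continuousAt.2 fun t => (hd i t).continuousAt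
  let D : ℕ → ℝ → ℂ := fun j t =>
    ∑ i ∈ Finset.range j, (-1) ^ (j - i) * (U i t * iteratedDeriv (j - 1 - i) φ t)
  have hD : ∀ j t, HasDerivAt (D j)
      (U 0 t * ((-1) ^ j * iteratedDeriv j φ t) - U j t * φ t) t := by
    intro j t
    have hs : HasDerivAt (D j) (∑ i ∈ Finset.range j, (-1) ^ (j - i) *
        (U (i + 1) t * iteratedDeriv (j - 1 - i) φ t +
          U i t * iteratedDeriv (j - 1 - i + 1) φ t)) t :=
      HasDerivAt.fun_sum fun i _ => ((hU i t).mul (hd _ t)).const_mul _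
    convert hs using 1
    have ht := Finset.sum_range_sub' (fun i => (-1) ^ (j - i) * (U i t * iteratedDeriv (j - i) φ t)) j
    simp only [Nat.sub_self, Nat.sub_zero, pow_zero, one_mul, iteratedDeriv_zero] at ht
    rw [show U 0 t * ((-1) ^ j * iteratedDeriv j φ t) - U j t * φ t =
      (-1) ^ j * (U 0 t * iteratedDeriv j φ t) - U j t * φ t by ring, ← ht]
    refine Finset.sum_congr rfl fun i hi => ?_
    rw [Finset.mem_range] at hi
    rw [show j - i = (j - 1 - i) + 1 by omega, show j - (i + 1) = j - 1 - i by omega, pow_succ]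
    ring
  let W : ℝ → ℂ := fun t => D m t + ∑ k ∈ Finset.Icc 1 m, c k * D (m - k) t
  have hW : ∀ t, HasDerivAt W (U 0 t * transposeODE m c φ t) t := by
    intro t
    have hs : HasDerivAt W _ t :=
      (hD m t).add (HasDerivAt.fun_sum fun k (_ : k ∈ Finset.Icc 1 m) => (hD (m - k) t).const_mul (c k))
    convert hs using 1
    have : (∑ k ∈ Finset.Icc 1 m, c k * U (m - k) t) = - U m t := by
      rw [eq_neg_iff_add_eq_zero, add_comm]; exact hQ t
    simp only [mul_sub, Finset.sum_sub_distrib, ← mul_assoc, ← Finset.sum_mul, this]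
    simp only [transposeODE, mul_add, Finset.mul_sum]
    have : ∀ x, U 0 t * (c x * ((-1) ^ (m - x) * iteratedDeriv (m - x) φ t)) =
        c x * U 0 t * (-1) ^ (m - x) * iteratedDeriv (m - x) φ t := fun x => by ring
    simp only [this]
    ring
  have hW0 : W 0 = - φ 0 := by
    have hDz : ∀ j < m, D j 0 = 0 := by
      intro j hj
      refine Finset.sum_eq_zero fun i hi => ?_
      rw [Finset.mem_range] at hi
      rw [h0 i (by omega)]; ring
    have hDm : D m 0 = - φ 0 := by
      obtain ⟨n, rfl⟩ : ∃ n, m = n + 1 := ⟨m - 1, by omega⟩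
      simp only [D]
      rw [Finset.sum_range_succ, Finset.sum_eq_zero]
      · simp at h1 ⊢; simp [h1]
      · intro i hi
        rw [Finset.mem_range] at hi
        rw [h0 i (by omega)]; ring
    simp only [W, hDm]
    rw [Finset.sum_eq_zero, add_zero]
    intro k hk
    rw [Finset.mem_Icc] at hk
    rw [hDz _ (by omega), mul_zero]
  -- a bound for the support of `φ`
  obtain ⟨R, hR⟩ := hφc.isCompact.isBounded.subset_closedBall 0
  have hz : ∀ t, |R| + 1 ≤ t → ∀ j, iteratedDeriv j φ t = 0 := by
    intro t ht j
    by_contra hne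
    have h2 : t ∈ tsupport φ := by
      by_contra h3
      apply hne
      have h4 : φ =ᶠ[nhds t] fun _ => 0 := notMem_tsupport_iff_eventuallyEq.1 h3
      rw [h4.iteratedDeriv_eq]
      simp
    have := hR h2
    rw [Metric.mem_closedBall, dist_zero_right, Real.norm_eq_abs] at this
    have h5 := le_abs_self t
    have h6 := le_abs_self R
    linarith
  have hT0 : (0 : ℝ) ≤ |R| + 1 := by positivity
  have hcont : Continuous fun t => U 0 t * transposeODE m c φ t := by
    simp only [transposeODE]
    have := hUc 0
    fun_prop
  have hint := intervalIntegral.integral_eq_sub_of_hasDerivAt (a := 0) (b := |R| + 1)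
    (fun t _ => hW t) (hcont.intervalIntegrable _ _)
  have hWT : W (|R| + 1) = 0 := by
    simp only [W, D, hz _ le_rfl]
    simp
  rw [hWT, hW0, sub_neg_eq_add, zero_add, intervalIntegral.integral_of_le hT0,
    ← integral_Icc_eq_integral_Ioc] at hint
  rw [← hint, ← integral_indicator measurableSet_Icc]
  refine integral_congr_ae (Filter.Eventually.of_forall fun t => ?_)
  simp only [indicator, mem_Icc]
  by_cases ht : t < 0
  · simp [ht, not_le.2 ht]
  · by_cases ht2 : t ≤ |R| + 1
    · simp [ht, not_lt.1 ht, ht2]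
    · have : transposeODE m c φ t = 0 := by
        simp [transposeODE, hz t (not_le.1 ht2).le]
      simp [this]

theorem IsForwardFundamentalSolution.locallyIntegrable {m : ℕ} {c : ℕ → ℂ} {u : ℝ → ℂ}
    (hu : IsForwardFundamentalSolution m c u) : LocallyIntegrable u := by
  have h1 : (Ici (0 : ℝ)).indicator u = u := by
    funext t
    by_cases ht : t < 0
    · simp [ht, hu.eq_zero_of_neg t ht]
    · simp [not_lt.1 ht]
  intro x
  refine ⟨Metric.closedBall x 1, Metric.closedBall_mem_nhds x one_pos, ?_⟩
  rw [← h1, integrableOn_indicator_iff measurableSet_Ici]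
  exact (hu.continuousOn.mono inter_subset_left).integrableOn_compact
    ((isCompact_closedBall x 1).inter_left isClosed_Ici)

theorem IsForwardFundamentalSolution.unique {m : ℕ} {c : ℕ → ℂ} {u v : ℝ → ℂ}
    (hu : IsForwardFundamentalSolution m c u) (hv : IsForwardFundamentalSolution m c v) :
    u = v := by
  have key : ∀ ψ : ℝ → ℂ, ContDiff ℝ ∞ ψ → HasCompactSupport ψ →
      ∫ s, u s * ψ s = ∫ s, v s * ψ s := by
    intro ψ hψ hψc
    have hshift : ∀ (w : ℝ → ℂ), IsForwardFundamentalSolution m c w → ∀ s,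
        ∫ t, w t * transposeODE m c ψ (s + t) = ψ s := by
      intro w hw s
      have h := hw.weak_eq (fun t => ψ (s + t)) (hψ.comp (contDiff_const.add contDiff_id))
        (hψc.comp_homeomorph (Homeomorph.addLeft s))
      simp only [transposeODE, iteratedDeriv_comp_const_add, add_zero] at h
      exact h
    set η := transposeODE m c ψ with hη
    have hηcont : Continuous η := by
      have : ∀ i, Continuous (iteratedDeriv i ψ) := fun i =>
        hψ.continuous_iteratedDeriv i (by exact_mod_cast le_top)
      change Continuous fun t => transposeODE m c ψ t
      simp only [transposeODE]
      fun_prop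
    obtain ⟨R, hR⟩ := hψc.isCompact.isBounded.subset_closedBall 0
    have hz : ∀ t, R < t → η t = 0 := by
      intro t ht
      have h2 : t ∉ tsupport ψ := by
        intro h3
        have := hR h3
        rw [Metric.mem_closedBall, dist_zero_right, Real.norm_eq_abs] at this
        have h5 := le_abs_self t
        linarith
      have h4 : ψ =ᶠ[nhds t] fun _ => 0 := notMem_tsupport_iff_eventuallyEq.1 h2
      simp [hη, transposeODE, h4.iteratedDeriv_eq]
    obtain ⟨K, hK⟩ := (isCompact_Icc (a := (0 : ℝ)) (b := R)).exists_bound_of_continuousOn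
      hηcont.continuousOn
    have hu1 : Integrable ((Icc 0 R).indicator u) :=
      (integrable_indicator_iff measurableSet_Icc).2
        (hu.locallyIntegrable.integrableOn_isCompact isCompact_Icc)
    have hv1 : Integrable ((Icc 0 R).indicator v) :=
      (integrable_indicator_iff measurableSet_Icc).2
        (hv.locallyIntegrable.integrableOn_isCompact isCompact_Icc)
    have hI : Integrable (Function.uncurry fun s t => u s * (v t * η (s + t)))
        (volume.prod volume) := by
      refine ((hu1.mul_prod hv1).norm.mul_const K).mono' ?_ ?_
      · exact (hu.locallyIntegrable.aestronglyMeasurable.comp_fst).mul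
          ((hv.locallyIntegrable.aestronglyMeasurable.comp_snd).mul
            (hηcont.comp (continuous_fst.add continuous_snd)).aestronglyMeasurable)
      · refine Filter.Eventually.of_forall fun ⟨s, t⟩ => ?_
        simp only [Function.uncurry]
        by_cases hs : s < 0
        · simp [hu.eq_zero_of_neg s hs, hs]
        by_cases ht : t < 0
        · simp [hv.eq_zero_of_neg t ht, ht]
        rw [not_lt] at hs ht
        by_cases hst : R < s + t
        · rw [hz _ hst]
          have : 0 ≤ R ∨ R < 0 := le_or_gt 0 R
          rcases this with h | h
          · have := (norm_nonneg _).trans (hK 0 ⟨le_rfl, h⟩)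
            simp only [mul_zero, norm_zero]
            positivity
          · simp [Icc_eq_empty (not_le.2 h)]
        · rw [not_lt] at hst
          have h1 : s ∈ Icc 0 R := ⟨hs, by linarith⟩
          have h2 : t ∈ Icc 0 R := ⟨ht, by linarith⟩
          rw [indicator_of_mem h1, indicator_of_mem h2, ← mul_assoc, norm_mul]
          exact mul_le_mul_of_nonneg_left (hK _ ⟨by linarith, hst⟩) (norm_nonneg _)
    calc ∫ s, u s * ψ s = ∫ s, ∫ t, u s * (v t * η (s + t)) := by
          simp only [integral_const_mul, hshift v hv]
      _ = ∫ t, ∫ s, u s * (v t * η (s + t)) := integral_integral_swap hI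
      _ = ∫ t, v t * ψ t := by
          refine integral_congr_ae (Filter.Eventually.of_forall fun t => ?_)
          simp only
          rw [← hshift u hu t, ← integral_const_mul]
          refine integral_congr_ae (Filter.Eventually.of_forall fun s => ?_)
          simp only [hη, add_comm s t]
          ring
  have hae : ∀ᵐ t, u t - v t = 0 := by
    refine ae_eq_zero_of_integral_contDiff_smul_eq_zero
      (hu.locallyIntegrable.sub hv.locallyIntegrable) ?_
    intro g hg hgc
    have hg' : ContDiff ℝ ∞ fun t => (g t : ℂ) := Complex.ofRealCLM.contDiff.comp hg
    have hgc' : HasCompactSupport fun t => (g t : ℂ) := hgc.comp_left Complex.ofReal_zero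
    have h := key _ hg' hgc'
    have hiu := hu.locallyIntegrable.integrable_smul_left_of_hasCompactSupport hg'.continuous hgc'
    have hiv := hv.locallyIntegrable.integrable_smul_left_of_hasCompactSupport hg'.continuous hgc'
    simp only [smul_eq_mul] at hiu hiv
    simp only [Complex.real_smul, mul_sub]
    rw [integral_sub hiu hiv, sub_eq_zero]
    simpa only [mul_comm] using h
  have hEq : EqOn u v (Ici 0) := by
    refine Measure.eqOn_of_ae_eq (μ := volume) ?_ hu.continuousOn hv.continuousOn ?_
    · refine ae_restrict_of_ae ?_
      filter_upwards [hae] with t ht using sub_eq_zero.1 ht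
    · rw [interior_Ici, closure_Ioi]
  funext t
  by_cases ht : t < 0
  · rw [hu.eq_zero_of_neg t ht, hv.eq_zero_of_neg t ht]
  · exact hEq (not_lt.1 ht)

theorem existsUnique_isForwardFundamentalSolution {m : ℕ} (hm : 0 < m) (c : ℕ → ℂ) :
    ∃! u, IsForwardFundamentalSolution m c u := by
  obtain ⟨u, hu⟩ := exists_isForwardFundamentalSolution hm c
  exact ⟨u, hu, fun v hv => hv.unique hu⟩

/-- The unique solution of `(∂_t^m + ∑_{k=1}^m c_k ∂_t^{m-k}) u = δ(t)` supported in `[0, ∞)`. -/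
noncomputable def forwardFundamentalSolution {m : ℕ} (hm : 0 < m) (c : ℕ → ℂ) : ℝ → ℂ :=
  (existsUnique_isForwardFundamentalSolution hm c).choose

theorem forwardFundamentalSolution_spec {m : ℕ} (hm : 0 < m) (c : ℕ → ℂ) :
    IsForwardFundamentalSolution m c (forwardFundamentalSolution hm c) :=
  (existsUnique_isForwardFundamentalSolution hm c).choose_spec.1

/-! ### Evolution operators -/

/-- The operator `P(∂_t, D_x) = ∂_t^m + ∑_{k=1}^m a_k(D_x) ∂_t^{m-k}`, `m ≥ 1`, with `a_k` arbitrary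
complex polynomials in `d` variables, `D_{x_j} = (2πi)⁻¹ ∂_{x_j}`. Only `a_1, …, a_m` matter. -/
structure EvolutionOperator (d : ℕ) where
  m : ℕ
  m_pos : 0 < m
  a : ℕ → MvPolynomial (Fin d) ℂ

/-- The polynomial `P(λ, ζ) = λ^m + ∑_{k=1}^m a_k(ζ) λ^{m-k}` on `ℂ × ℂ^d`. -/
noncomputable def EvolutionOperator.symbol {d : ℕ} (P : EvolutionOperator d)
    (l : ℂ) (ζ : Fin d → ℂ) : ℂ :=
  l ^ P.m + ∑ k ∈ Finset.Icc 1 P.m, MvPolynomial.eval ζ (P.a k) * l ^ (P.m - k)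

/-- The refined forward Hadamard-Petrowsky condition: there is `C > 0` such that, for all
`(τ, ζ) ∈ ℂ × ℂ^d`, `P(iτ, ζ) = 0` implies `Im τ ≥ -C (1 + |Im ζ|)^ν`. -/
def EvolutionOperator.RefinedHadamardPetrowsky {d : ℕ} (P : EvolutionOperator d) (ν : ℝ) : Prop :=
  ∃ C : ℝ, 0 < C ∧ ∀ (τ : ℂ) (ζ : Fin d → ℂ), P.symbol (Complex.I * τ) ζ = 0 →
    -C * (1 + ‖(WithLp.toLp 2 (fun j => (ζ j).im) : E d)‖) ^ ν ≤ τ.im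

/-- The symbol `σ(t, ξ)` of the propagator: for every `ξ ∈ ℝ^d`, the unique solution of
`(∂_t^m + ∑_{k=1}^m a_k(ξ) ∂_t^{m-k}) σ(t, ξ) = δ(t)` supported in `t ≥ 0`. -/
noncomputable def EvolutionOperator.propagatorSymbol {d : ℕ} (P : EvolutionOperator d)
    (t : ℝ) (ξ : E d) : ℂ :=
  forwardFundamentalSolution P.m_pos
    (fun k => MvPolynomial.eval (fun j => (ξ j : ℂ)) (P.a k)) t

/-- The propagator `σ(t, D_x) f = 𝓕⁻¹ (σ(t, ·) 𝓕 f)`. -/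
noncomputable def EvolutionOperator.propagator {d : ℕ} (P : EvolutionOperator d)
    (t : ℝ) (f : E d → ℂ) : E d → ℂ :=
  fourierMultiplier (P.propagatorSymbol t) f

/-- The exponent `r = min {2, ν/(ν-1)}`, where `ν/(ν-1) = ∞` (hence `r = 2`) for `ν = 1`. -/
noncomputable def decayExponent (ν : ℝ) : ℝ :=
  if ν = 1 then 2 else min 2 (ν / (ν - 1))

end GaborEvolution

namespace GaborEvolution

/-! By Parseval the matrix entry is `∫ σ(t,ξ) 𝓕(π(z)g)(ξ) conj(𝓕(π(w)g)(ξ)) dξ`, and the decay comes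
from moving this integral to `ℝ^d + iη` for a well-chosen `η`.

The symbol extends to an entire function: the ODE solution depends holomorphically on its
coefficients, which are polynomials in `ζ` (`exists_isClassicalSolution_differentiable`). The
characteristic roots `λ = iτ` satisfy `Re λ ≤ C₀(1+|Im ζ|)^ν`. A bound on the solution in terms of
the largest real part of the roots alone (`IsClassicalSolution.norm_le`) gives `|σ(t,ζ)| ≤ C
exp(C₀T(1+|Im ζ|)^ν)` for `0 ≤ t ≤ T`, with no growth in `Re ζ`.

Let `q` be conjugate to `r`, so `q = max(2, ν)`. The Gelfand-Shilov estimates amount to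
`exp(-ε|·|^r)` decay, and the Fourier-Laplace transform of `g` at `ξ + iη` is `O(exp(-ε|ξ|^r +
D|η|^q))` (`GelfandShilov.exists_fourierLaplace_bound`).

After the shift (`integral_cplx_zero_eq`) the two translations contribute `exp(-2π u·η)`, where `u`
is the difference of the positions. For `η` parallel to `u` with `|η| = δ|u|^(r-1)` the gain is
`2πδ|u|^r`, while `|η|^q = δ^q|u|^r` and `ν ≤ q`, so for small `δ` the gain wins (`exists_contour`).
Decay in the frequency difference comes from the product of the two transformed windows. All
constants depend on the symbol only through its growth bound, hence uniformity in `t`. -/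

/-! ### The classical solution: holomorphic dependence and identification with the fundamental
solution. -/

/-- `U i`, `i ∈ ℕ`, are the derivatives of the solution of
`(∂_t^m + ∑_{k=1}^m c_k ∂_t^{m-k}) U = 0` with Cauchy data `(0, …, 0, 1)` at `t = 0`. -/
structure IsClassicalSolution (m : ℕ) (c : ℕ → ℂ) (U : ℕ → ℝ → ℂ) : Prop where
  hasDerivAt : ∀ i t, HasDerivAt (U i) (U (i + 1) t) t
  zero : ∀ i, i + 1 < m → U i 0 = 0
  one : U (m - 1) 0 = 1
  eq : ∀ t, U m t + ∑ k ∈ Finset.Icc 1 m, c k * U (m - k) t = 0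

/-- The classical solution depends holomorphically on the coefficients. -/
theorem exists_isClassicalSolution_differentiable {V : Type*} [NormedAddCommGroup V]
    [NormedSpace ℂ V] (m : ℕ) (hm : 0 < m) (c : V → ℕ → ℂ)
    (hc : ∀ k, Differentiable ℂ fun v => c v k) :
    ∃ U : V → ℕ → ℝ → ℂ, (∀ v, IsClassicalSolution m (c v) (U v)) ∧
      ∀ t, Differentiable ℂ fun v => U v 0 t := by
  let ext : (Fin m → ℂ) → ℕ → ℂ := fun y i => if h : i < m then y ⟨i, h⟩ else 0
  have hadd : ∀ y z i, ext (y + z) i = ext y i + ext z i := by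
    intro y z i; simp only [ext]; split_ifs <;> simp
  have hsmul : ∀ (a : ℂ) y i, ext (a • y) i = a * ext y i := by
    intro a y i; simp only [ext]; split_ifs <;> simp
  let S₀ : (Fin m → ℂ) →ₗ[ℂ] (Fin m → ℂ) :=
    { toFun := fun y i => if i.1 + 1 < m then ext y (i.1 + 1) else 0
      map_add' := by
        intro y z
        funext i
        simp only [hadd, Pi.add_apply]
        split_ifs <;> simp
      map_smul' := by
        intro a y
        funext i
        simp only [hsmul, Pi.smul_apply, smul_eq_mul, RingHom.id_apply]
        split_ifs <;> simp }
  let N₀ : ℕ → (Fin m → ℂ) →ₗ[ℂ] (Fin m → ℂ) := fun k =>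
    { toFun := fun y i => if i.1 + 1 < m then 0 else ext y (m - k)
      map_add' := by
        intro y z
        funext i
        simp only [hadd, Pi.add_apply]
        split_ifs <;> simp
      map_smul' := by
        intro a y
        funext i
        simp only [hsmul, Pi.smul_apply, smul_eq_mul, RingHom.id_apply]
        split_ifs <;> simp }
  let S : (Fin m → ℂ) →L[ℂ] (Fin m → ℂ) := LinearMap.toContinuousLinearMap S₀
  let N : ℕ → (Fin m → ℂ) →L[ℂ] (Fin m → ℂ) := fun k => LinearMap.toContinuousLinearMap (N₀ k)
  -- The companion matrix is affine in the coefficients: a fixed shift `S` minus `c v k` times fixed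
  -- operators `N k`. This makes it, and then its exponential, holomorphic in `v`.
  let A : V → (Fin m → ℂ) →L[ℂ] (Fin m → ℂ) := fun v => S - ∑ k ∈ Finset.Icc 1 m, c v k • N k
  let e : Fin m → ℂ := Pi.single ⟨m - 1, by omega⟩ 1
  let ℓ : (Fin m → ℂ) →L[ℂ] ℂ := ContinuousLinearMap.proj ⟨0, hm⟩
  have hA : ∀ v y i, A v y i = if i.1 + 1 < m then ext y (i.1 + 1)
        else - ∑ k ∈ Finset.Icc 1 m, c v k * ext y (m - k) := by
    intro v y i
    have h1 : A v y i = S₀ y i - ∑ k ∈ Finset.Icc 1 m, c v k * N₀ k y i := by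
      simp [A, S, N, Finset.sum_apply]
    rw [h1]
    change (if i.1 + 1 < m then ext y (i.1 + 1) else 0) - ∑ k ∈ Finset.Icc 1 m, c v k *
      (if i.1 + 1 < m then 0 else ext y (m - k)) = _
    split_ifs <;> simp
  -- Coordinate `0` of `A ^ i y` is `y i` for `i < m`. Hence the `i`-th derivative of the first
  -- component of the flow is its `i`-th component, from which both the Cauchy data and the equation
  -- are read off.
  have hpow : ∀ v i (hi : i < m) y, ((A v ^ i) y) ⟨0, hm⟩ = y ⟨i, hi⟩ := by
    intro v i
    induction i with
    | zero => intro hi y; simp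
    | succ i ih =>
      intro hi y
      rw [pow_succ, mul_apply_eq_comp, ih (by omega), hA]
      simp [hi, ext]
  have hexp : ∀ v, NormedSpace.exp ((0 : ℝ) • A v) = 1 := fun v => by
    rw [zero_smul ℝ (A v)]; exact NormedSpace.exp_zero
  refine ⟨fun v i t => ℓ ((A v ^ i) ((NormedSpace.exp (t • A v)) e)), fun v => ⟨?_, ?_, ?_, ?_⟩, ?_⟩
  · intro i t
    have h1 := hasDerivAt_exp_smul_const' (𝕂 := ℝ) (A v) t
    let L : ((Fin m → ℂ) →L[ℂ] (Fin m → ℂ)) →L[ℝ] ℂ :=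
      ((ℓ ∘L (A v ^ i)).restrictScalars ℝ) ∘L
        ((ContinuousLinearMap.apply ℂ (Fin m → ℂ) e).restrictScalars ℝ)
    have h2 := L.hasFDerivAt.comp_hasDerivAt t h1
    have h3 : L (A v * NormedSpace.exp (t • A v)) =
        ℓ ((A v ^ (i + 1)) ((NormedSpace.exp (t • A v)) e)) := by
      rw [pow_succ]; rfl
    rw [h3] at h2
    exact h2
  · intro i hi
    simp only [ℓ, ContinuousLinearMap.proj_apply, hpow v i (by omega)]
    rw [hexp, one_apply_eq_self]
    simp only [e]
    rw [Pi.single_eq_of_ne]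
    intro h
    have := congrArg Fin.val h
    simp at this
    omega
  · simp only [ℓ, ContinuousLinearMap.proj_apply, hpow v (m - 1) (by omega)]
    rw [hexp, one_apply_eq_self]
    simp [e]
  · intro t
    simp only [ℓ, ContinuousLinearMap.proj_apply]
    generalize (NormedSpace.exp (t • A v)) e = y
    have h1 : ((A v ^ m) y) ⟨0, hm⟩ = - ∑ k ∈ Finset.Icc 1 m, c v k * ext y (m - k) := by
      obtain ⟨n, rfl⟩ : ∃ n, m = n + 1 := ⟨m - 1, by omega⟩
      rw [pow_succ, mul_apply_eq_comp, hpow v n (by omega), hA]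
      simp
    rw [h1, neg_add_eq_zero]
    refine Finset.sum_congr rfl fun k hk => ?_
    rw [Finset.mem_Icc] at hk
    rw [hpow v (m - k) (by omega)]
    simp only [ext]
    rw [dif_pos]
  · intro t
    have hAd : Differentiable ℂ A := by
      refine (differentiable_const _).sub (Differentiable.fun_sum fun k _ => ?_)
      exact (hc k).smul_const _
    have hE : Differentiable ℂ fun v => NormedSpace.exp ((t : ℂ) • A v) := fun v =>
      ((NormedSpace.exp_analytic ((t : ℂ) • A v)).differentiableAt).comp v
        ((hAd v).const_smul (t : ℂ))
    have h2 : Differentiable ℂ fun v => ℓ (NormedSpace.exp ((t : ℂ) • A v) e) :=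
      ℓ.differentiable.comp (hE.clm_apply (differentiable_const e))
    have h3 : ∀ v, (t : ℂ) • A v = t • A v := fun v => by
      ext y i; simp
    simpa only [pow_zero, one_apply_eq_self, h3] using h2

theorem IsClassicalSolution.isForwardFundamentalSolution {m : ℕ} (hm : 0 < m) {c : ℕ → ℂ}
    {U : ℕ → ℝ → ℂ} (hUU : IsClassicalSolution m c U) :
    IsForwardFundamentalSolution m c (fun t => if t < 0 then 0 else U 0 t) := by
  obtain ⟨hU, h0, h1, hQ⟩ := hUU
  have hUc : ∀ i, Continuous (U i) := fun i =>
    continuous_iff_continuousAt.2 fun t => (hU i t).continuousAt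
  refine ⟨fun t ht => if_pos ht, ?_, ?_⟩
  · refine (hUc 0).continuousOn.congr fun t ht => ?_
    exact if_neg (not_lt.2 ht)
  intro φ hφ hφc
  have hd : ∀ i t, HasDerivAt (iteratedDeriv i φ) (iteratedDeriv (i + 1) φ t) t := by
    intro i t
    rw [iteratedDeriv_succ]
    exact ((hφ.differentiable_iteratedDeriv i (by exact_mod_cast ENat.natCast_lt_top i)) t).hasDerivAt
  have hφd : ∀ i, Continuous (iteratedDeriv i φ) := fun i =>
    continuous_iff_continuousAt.2 fun t => (hd i t).continuousAt
  -- Boundary terms of `j` integrations by parts. The derivative telescopes, leaving only the terms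
  -- with all derivatives on `φ` or all on `U`. At `0` the Cauchy data kill every term except `i = m
  -- - 1` in `D m`, which yields `φ 0`.
  let D : ℕ → ℝ → ℂ := fun j t =>
    ∑ i ∈ Finset.range j, (-1) ^ (j - i) * (U i t * iteratedDeriv (j - 1 - i) φ t)
  have hD : ∀ j t, HasDerivAt (D j)
      (U 0 t * ((-1) ^ j * iteratedDeriv j φ t) - U j t * φ t) t := by
    intro j t
    have hs : HasDerivAt (D j) (∑ i ∈ Finset.range j, (-1) ^ (j - i) *
        (U (i + 1) t * iteratedDeriv (j - 1 - i) φ t +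
          U i t * iteratedDeriv (j - 1 - i + 1) φ t)) t :=
      HasDerivAt.fun_sum fun i _ => ((hU i t).mul (hd _ t)).const_mul _
    convert hs using 1
    have ht := Finset.sum_range_sub' (fun i => (-1) ^ (j - i) * (U i t * iteratedDeriv (j - i) φ t)) j
    simp only [Nat.sub_self, Nat.sub_zero, pow_zero, one_mul, iteratedDeriv_zero] at ht
    rw [show U 0 t * ((-1) ^ j * iteratedDeriv j φ t) - U j t * φ t =
      (-1) ^ j * (U 0 t * iteratedDeriv j φ t) - U j t * φ t by ring, ← ht]
    refine Finset.sum_congr rfl fun i hi => ?_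
    rw [Finset.mem_range] at hi
    rw [show j - i = (j - 1 - i) + 1 by omega, show j - (i + 1) = j - 1 - i by omega, pow_succ]
    ring
  let W : ℝ → ℂ := fun t => D m t + ∑ k ∈ Finset.Icc 1 m, c k * D (m - k) t
  have hW : ∀ t, HasDerivAt W (U 0 t * transposeODE m c φ t) t := by
    intro t
    have hs : HasDerivAt W _ t :=
      (hD m t).add (HasDerivAt.fun_sum fun k (_ : k ∈ Finset.Icc 1 m) => (hD (m - k) t).const_mul (c k))
    convert hs using 1
    have : (∑ k ∈ Finset.Icc 1 m, c k * U (m - k) t) = - U m t := by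
      rw [eq_neg_iff_add_eq_zero, add_comm]; exact hQ t
    simp only [mul_sub, Finset.sum_sub_distrib, ← mul_assoc, ← Finset.sum_mul, this]
    simp only [transposeODE, mul_add, Finset.mul_sum]
    have : ∀ x, U 0 t * (c x * ((-1) ^ (m - x) * iteratedDeriv (m - x) φ t)) =
        c x * U 0 t * (-1) ^ (m - x) * iteratedDeriv (m - x) φ t := fun x => by ring
    simp only [this]
    ring
  have hW0 : W 0 = - φ 0 := by
    have hDz : ∀ j < m, D j 0 = 0 := by
      intro j hj
      refine Finset.sum_eq_zero fun i hi => ?_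
      rw [Finset.mem_range] at hi
      rw [h0 i (by omega)]; ring
    have hDm : D m 0 = - φ 0 := by
      obtain ⟨n, rfl⟩ : ∃ n, m = n + 1 := ⟨m - 1, by omega⟩
      simp only [D]
      rw [Finset.sum_range_succ, Finset.sum_eq_zero]
      · simp at h1 ⊢; simp [h1]
      · intro i hi
        rw [Finset.mem_range] at hi
        rw [h0 i (by omega)]; ring
    simp only [W, hDm]
    rw [Finset.sum_eq_zero, add_zero]
    intro k hk
    rw [Finset.mem_Icc] at hk
    rw [hDz _ (by omega), mul_zero]
  -- a bound for the support of `φ`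
  obtain ⟨R, hR⟩ := hφc.isCompact.isBounded.subset_closedBall 0
  have hz : ∀ t, |R| + 1 ≤ t → ∀ j, iteratedDeriv j φ t = 0 := by
    intro t ht j
    by_contra hne
    have h2 : t ∈ tsupport φ := by
      by_contra h3
      apply hne
      have h4 : φ =ᶠ[nhds t] fun _ => 0 := notMem_tsupport_iff_eventuallyEq.1 h3
      rw [h4.iteratedDeriv_eq]
      simp
    have := hR h2
    rw [Metric.mem_closedBall, dist_zero_right, Real.norm_eq_abs] at this
    have h5 := le_abs_self t
    have h6 := le_abs_self R
    linarith
  have hT0 : (0 : ℝ) ≤ |R| + 1 := by positivity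
  have hcont : Continuous fun t => U 0 t * transposeODE m c φ t := by
    simp only [transposeODE]
    have := hUc 0
    fun_prop
  have hint := intervalIntegral.integral_eq_sub_of_hasDerivAt (a := 0) (b := |R| + 1)
    (fun t _ => hW t) (hcont.intervalIntegrable _ _)
  have hWT : W (|R| + 1) = 0 := by
    simp only [W, D, hz _ le_rfl]
    simp
  rw [hWT, hW0, sub_neg_eq_add, zero_add, intervalIntegral.integral_of_le hT0,
    ← integral_Icc_eq_integral_Ioc] at hint
  rw [← hint, ← integral_indicator measurableSet_Icc]
  refine integral_congr_ae (Filter.Eventually.of_forall fun t => ?_)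
  simp only [indicator, mem_Icc]
  by_cases ht : t < 0
  · simp [ht, not_le.2 ht]
  · by_cases ht2 : t ≤ |R| + 1
    · simp [ht, not_lt.1 ht, ht2]
    · have : transposeODE m c φ t = 0 := by
        simp [transposeODE, hz t (not_le.1 ht2).le]
      simp [this]

theorem IsClassicalSolution.forwardFundamentalSolution_eq {m : ℕ} (hm : 0 < m) {c : ℕ → ℂ}
    {U : ℕ → ℝ → ℂ} (hU : IsClassicalSolution m c U) {t : ℝ} (ht : 0 ≤ t) :
    forwardFundamentalSolution hm c t = U 0 t := by
  rw [(forwardFundamentalSolution_spec hm c).unique (hU.isForwardFundamentalSolution hm)]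
  exact if_neg (not_lt.2 ht)

/-! ### Growth of the solution in terms of the real parts of the characteristic roots. -/

/-- The value at time `t` of `p(∂_t) U`. -/
noncomputable def applyPoly (U : ℕ → ℝ → ℂ) (t : ℝ) : Polynomial ℂ →ₗ[ℂ] ℂ :=
  (Polynomial.basisMonomials ℂ).constr ℂ fun i => U i t

theorem applyPoly_monomial (U : ℕ → ℝ → ℂ) (t : ℝ) (i : ℕ) (a : ℂ) :
    applyPoly U t (Polynomial.monomial i a) = a * U i t := by
  have h := (Polynomial.basisMonomials ℂ).constr_basis ℂ (fun i => U i t) i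
  rw [Polynomial.coe_basisMonomials] at h
  rw [← mul_one a, ← smul_eq_mul a 1, ← Polynomial.smul_monomial, map_smul, applyPoly, h]
  simp

theorem hasDerivAt_applyPoly {U : ℕ → ℝ → ℂ} (hU : ∀ i t, HasDerivAt (U i) (U (i + 1) t) t)
    (p : Polynomial ℂ) (t : ℝ) :
    HasDerivAt (fun t => applyPoly U t p) (applyPoly U t (Polynomial.X * p)) t := by
  induction p using Polynomial.induction_on' with
  | add p q hp hq => simpa only [map_add, mul_add] using hp.fun_add hq
  | monomial i a =>
    rw [Polynomial.X_mul_monomial]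
    simp only [applyPoly_monomial]
    exact (hU i t).const_mul a

theorem applyPoly_eq_sum (U : ℕ → ℝ → ℂ) (t : ℝ) (p : Polynomial ℂ) :
    applyPoly U t p = ∑ i ∈ Finset.range (p.natDegree + 1), p.coeff i * U i t := by
  conv_lhs => rw [p.as_sum_range]
  rw [map_sum]
  simp only [applyPoly_monomial]

/-- With Cauchy data `(0, …, 0, 1)` only the leading coefficient can survive, and only when the
degree is `m - 1`. The bound is therefore independent of the lower coefficients, that is, of the
size of the roots. -/
theorem IsClassicalSolution.norm_applyPoly_zero_le {m : ℕ} {c : ℕ → ℂ} {U : ℕ → ℝ → ℂ}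
    (hU : IsClassicalSolution m c U) {p : Polynomial ℂ} (hp : p.Monic) (hd : p.natDegree < m) :
    ‖applyPoly U 0 p‖ ≤ 1 := by
  rw [applyPoly_eq_sum, Finset.sum_range_succ, Finset.sum_eq_zero, zero_add, hp.coeff_natDegree,
    one_mul]
  · by_cases h : p.natDegree + 1 < m
    · simp [hU.zero _ h]
    · rw [show p.natDegree = m - 1 by omega, hU.one]; simp
  · intro i hi
    rw [Finset.mem_range] at hi
    rw [hU.zero i (by omega), mul_zero]

/-- Variation of constants for one first-order factor. -/
theorem norm_le_of_hasDerivAt_sub {f h : ℝ → ℂ} {l : ℂ} {K M T : ℝ} (hK : 0 ≤ K)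
    (hl : l.re ≤ M) (hf : ∀ t, HasDerivAt f (h t + l * f t) t) (hf0 : ‖f 0‖ ≤ 1)
    (hh : ∀ t ∈ Icc 0 T, ‖h t‖ ≤ K * Real.exp (M * t)) :
    ∀ t ∈ Icc 0 T, ‖f t‖ ≤ (1 + T * K) * Real.exp (M * t) := by
  intro t ht
  have hE : ∀ s : ℝ, HasDerivAt (fun s : ℝ => Complex.exp (-l * s)) (Complex.exp (-l * s) * -l) s := by
    intro s
    have h1 : HasDerivAt (fun s : ℝ => -l * (s : ℂ)) (-l * 1) s :=
      (Complex.ofRealCLM.hasDerivAt (x := s)).const_mul (-l)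
    simpa using h1.cexp
  -- The integrating factor `e^{-ls}` removes the term `l f`. Since `M - Re l ≥ 0`, the derivative
  -- is largest at the right endpoint, and the mean value inequality applies.
  have hg : ∀ s : ℝ, HasDerivAt (fun s : ℝ => Complex.exp (-l * s) * f s)
      (Complex.exp (-l * s) * h s) s := by
    intro s
    exact ((hE s).fun_mul (hf s)).congr_deriv (by ring)
  have hnorm : ∀ s : ℝ, ‖Complex.exp (-l * s)‖ = Real.exp (-l.re * s) := by
    intro s; rw [Complex.norm_exp]; simp
  have hb := norm_image_sub_le_of_norm_deriv_le_segment' (a := 0) (b := t)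
    (C := K * Real.exp ((M - l.re) * t))
    (fun s _ => (hg s).hasDerivWithinAt) (by
      intro s hs
      rw [norm_mul, hnorm]
      have h1 := hh s ⟨hs.1, hs.2.le.trans ht.2⟩
      calc Real.exp (-l.re * s) * ‖h s‖ ≤ Real.exp (-l.re * s) * (K * Real.exp (M * s)) := by gcongr
        _ = K * Real.exp ((M - l.re) * s) := by
          rw [mul_left_comm, ← Real.exp_add]; ring_nf
        _ ≤ K * Real.exp ((M - l.re) * t) := by
          have : 0 ≤ M - l.re := by linarith
          have := hs.2
          gcongr) t ⟨ht.1, le_rfl⟩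
  simp only [Complex.ofReal_zero, mul_zero, Complex.exp_zero, one_mul, sub_zero] at hb
  have h2 : ‖Complex.exp (-l * t) * f t‖ ≤ 1 + K * Real.exp ((M - l.re) * t) * t := by
    have := norm_le_norm_add_norm_sub' (Complex.exp (-l * t) * f t) (f 0)
    linarith
  have h3 : ‖f t‖ = Real.exp (l.re * t) * ‖Complex.exp (-l * t) * f t‖ := by
    rw [norm_mul, hnorm, ← mul_assoc, ← Real.exp_add]; simp
  have h4 : Real.exp (l.re * t) ≤ Real.exp (M * t) := by
    have := ht.1
    gcongr
  calc ‖f t‖ ≤ Real.exp (l.re * t) * (1 + K * Real.exp ((M - l.re) * t) * t) := by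
        rw [h3]; gcongr
    _ = Real.exp (l.re * t) + t * K * Real.exp (M * t) := by
        have : Real.exp (M * t) = Real.exp (l.re * t) * Real.exp ((M - l.re) * t) := by
          rw [← Real.exp_add]; ring_nf
        rw [this]; ring
    _ ≤ Real.exp (M * t) + T * K * Real.exp (M * t) := by
        have := ht.2
        gcongr
    _ = _ := by ring

/-- The characteristic polynomial `X^m + ∑ c_k X^{m-k}`. -/
noncomputable def charPoly (m : ℕ) (c : ℕ → ℂ) : Polynomial ℂ :=
  Polynomial.X ^ m + ∑ k ∈ Finset.Icc 1 m, Polynomial.C (c k) * Polynomial.X ^ (m - k)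

theorem degree_charPoly_tail (m : ℕ) (c : ℕ → ℂ) :
    (∑ k ∈ Finset.Icc 1 m, Polynomial.C (c k) * Polynomial.X ^ (m - k)).degree < (m : WithBot ℕ) := by
  refine (Polynomial.degree_sum_le _ _).trans_lt ((Finset.sup_lt_iff (WithBot.bot_lt_coe m)).2 ?_)
  intro k hk
  rw [Finset.mem_Icc] at hk
  refine (Polynomial.degree_C_mul_X_pow_le _ _).trans_lt ?_
  exact Nat.cast_lt.2 (by omega : m - k < m)

theorem monic_charPoly (m : ℕ) (c : ℕ → ℂ) : (charPoly m c).Monic :=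
  Polynomial.monic_X_pow_add (degree_charPoly_tail m c)

theorem natDegree_charPoly (m : ℕ) (c : ℕ → ℂ) : (charPoly m c).natDegree = m := by
  refine Polynomial.natDegree_eq_of_degree_eq_some ?_
  rw [charPoly, Polynomial.degree_add_eq_left_of_degree_lt, Polynomial.degree_X_pow]
  rw [Polynomial.degree_X_pow]
  exact degree_charPoly_tail m c

theorem IsClassicalSolution.applyPoly_charPoly {m : ℕ} {c : ℕ → ℂ} {U : ℕ → ℝ → ℂ}
    (hU : IsClassicalSolution m c U) (t : ℝ) : applyPoly U t (charPoly m c) = 0 := by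
  rw [← hU.eq t, charPoly, map_add, map_sum, Polynomial.X_pow_eq_monomial, applyPoly_monomial]
  simp only [Polynomial.C_mul_X_pow_eq_monomial, applyPoly_monomial, one_mul]

/-- Factor the characteristic polynomial into `∂_t - l` and invert the factors one at a time. Each
inversion changes the constant `K` into `1 + T K`, which produces the geometric sum. Neither the
coefficients nor the imaginary parts of the roots enter, so the estimate is uniform in `ζ`. -/
theorem IsClassicalSolution.norm_le {m : ℕ} {c : ℕ → ℂ} {U : ℕ → ℝ → ℂ}
    (hU : IsClassicalSolution m c U) {M T : ℝ} (hT : 0 ≤ T)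
    (hM : ∀ l : ℂ, l ^ m + ∑ k ∈ Finset.Icc 1 m, c k * l ^ (m - k) = 0 → l.re ≤ M) :
    ∀ t ∈ Icc 0 T, ‖U 0 t‖ ≤ (∑ i ∈ Finset.range m, T ^ i) * Real.exp (M * t) := by
  -- `s` holds the roots already inverted and `p` is the complementary factor. For `s = 0` the value
  -- is zero by the equation; for `p = 1` it is `U 0` itself.
  have key : ∀ (s : Multiset ℂ) (p : Polynomial ℂ), (∀ l ∈ s, l.re ≤ M) → p.Monic →
      (s.map fun l => Polynomial.X - Polynomial.C l).prod * p = charPoly m c →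
      ∀ t ∈ Icc 0 T, ‖applyPoly U t p‖ ≤
        (∑ i ∈ Finset.range s.card, T ^ i) * Real.exp (M * t) := by
    intro s
    induction s using Multiset.induction_on with
    | empty =>
      intro p _ _ h t _
      simp only [Multiset.map_zero, Multiset.prod_zero, one_mul] at h
      simp [h, hU.applyPoly_charPoly]
    | cons l s ih =>
      intro p hs hp h t ht
      rw [Multiset.map_cons, Multiset.prod_cons] at h
      have hq : ((Polynomial.X - Polynomial.C l) * p).Monic := (Polynomial.monic_X_sub_C l).mul hp
      have hi := ih ((Polynomial.X - Polynomial.C l) * p)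
        (fun a ha => hs a (Multiset.mem_cons_of_mem ha)) hq (by rw [← h]; ring)
      have hdeg : p.natDegree < m := by
        have h1 := congrArg Polynomial.natDegree h
        rw [natDegree_charPoly, mul_right_comm, mul_comm, Polynomial.Monic.natDegree_mul
          (Polynomial.monic_multiset_prod_of_monic _ _ fun a _ => Polynomial.monic_X_sub_C a) hq,
          Polynomial.Monic.natDegree_mul (Polynomial.monic_X_sub_C l) hp,
          Polynomial.natDegree_X_sub_C] at h1
        omega
      have h2 := norm_le_of_hasDerivAt_sub (f := fun t => applyPoly U t p) (l := l)
        (by positivity) (hs l (Multiset.mem_cons_self l s)) (fun t => by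
          have := hasDerivAt_applyPoly hU.hasDerivAt p t
          rwa [show Polynomial.X * p = (Polynomial.X - Polynomial.C l) * p + l • p by
            rw [Polynomial.smul_eq_C_mul]; ring, map_add, map_smul, smul_eq_mul] at this)
        (hU.norm_applyPoly_zero_le hp hdeg) hi t ht
      rw [Multiset.card_cons, Finset.sum_range_succ', pow_zero]
      simp only [pow_succ']
      rwa [← Finset.mul_sum, add_comm]
  intro t ht
  have hsplit : ((charPoly m c).roots.map fun l => Polynomial.X - Polynomial.C l).prod * 1 =
      charPoly m c := by
    rw [mul_one, ← (IsAlgClosed.splits (charPoly m c)).eq_prod_roots_of_monic (monic_charPoly m c)]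
  have h := key _ 1 (fun l hl => hM l (by
    have := (Polynomial.mem_roots'.1 hl).2
    simpa [charPoly, Polynomial.eval_finsetSum] using this)) Polynomial.monic_one hsplit t ht
  have hcard : (charPoly m c).roots.card = m := by
    rw [← (IsAlgClosed.splits (charPoly m c)).natDegree_eq_card_roots, natDegree_charPoly]
  rwa [hcard, ← Polynomial.monomial_zero_one, applyPoly_monomial, one_mul] at h

/-! ### Elementary inequalities -/

/-- Factorial moment bounds give exponential decay. -/
theorem le_exp_of_forall_pow_mul_le {r A K X y : ℝ} (hr : 1 ≤ r) (hA : 0 < A) (hX : 0 ≤ X)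
    (hy : 0 ≤ y) (hK : 0 ≤ K)
    (h : ∀ n : ℕ, X ^ n * y ≤ K * (A ^ n * (n.factorial : ℝ) ^ (1 / r))) :
    y ≤ 2 * K * Real.exp (-(2 * r * A ^ r)⁻¹ * X ^ r) := by
  have hr0 : 0 < r := by linarith
  have hAr : 0 < A ^ r := Real.rpow_pos_of_pos hA r
  set Y := X ^ r / (2 * A ^ r) with hY
  -- The `r`-th power turns `(n!)^{1/r}` into `n!`, so the moments are comparable with the terms of
  -- the series of `exp Y`. The factor `2` in `Y` leaves a summable `2^{-n}`.
  have hn : ∀ n : ℕ, Y ^ n / n.factorial * y ^ r ≤ K ^ r * (1 / 2) ^ n := by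
    intro n
    have h1 := Real.rpow_le_rpow (by positivity) (h n) hr0.le
    rw [Real.mul_rpow (by positivity) hy, Real.mul_rpow hK (by positivity),
      Real.mul_rpow (by positivity) (by positivity), ← Real.rpow_mul (by positivity),
      one_div_mul_cancel hr0.ne', Real.rpow_one, ← Real.rpow_natCast_mul hX,
      ← Real.rpow_natCast_mul hA.le, mul_comm (n : ℝ) r, Real.rpow_mul_natCast hX,
      Real.rpow_mul_natCast hA.le] at h1
    have hf : (0 : ℝ) < n.factorial := by exact_mod_cast n.factorial_pos
    calc Y ^ n / n.factorial * y ^ r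
        = ((X ^ r) ^ n * y ^ r) * ((1 / 2) ^ n / ((A ^ r) ^ n * n.factorial)) := by
          rw [hY, div_pow, mul_pow, one_div, inv_pow]; field_simp
      _ ≤ (K ^ r * ((A ^ r) ^ n * n.factorial)) * ((1 / 2) ^ n / ((A ^ r) ^ n * n.factorial)) := by
          gcongr
      _ = K ^ r * (1 / 2) ^ n := by field_simp
  have hs : HasSum (fun n : ℕ => Y ^ n / n.factorial * y ^ r) (Real.exp Y * y ^ r) := by
    rw [Real.exp_eq_exp_ℝ]
    exact (NormedSpace.expSeries_div_hasSum_exp Y).mul_right _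
  have h2 : Real.exp Y * y ^ r ≤ K ^ r * 2 := hasSum_le hn hs (hasSum_geometric_two.mul_left _)
  have h3 : y ^ r ≤ (2 * K * Real.exp (-(2 * r * A ^ r)⁻¹ * X ^ r)) ^ r := by
    have h4 : Real.exp (-(2 * r * A ^ r)⁻¹ * X ^ r) ^ r = Real.exp (-Y) := by
      rw [← Real.exp_mul]
      congr 1
      rw [hY]
      field_simp
    rw [Real.mul_rpow (by positivity) (by positivity), h4, Real.mul_rpow (by positivity) hK,
      Real.exp_neg, ← div_eq_mul_inv, le_div_iff₀ (Real.exp_pos _), mul_comm]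
    have h5 : (2 : ℝ) ≤ 2 ^ r := by simpa using Real.rpow_le_rpow_of_exponent_le (by norm_num) hr
    calc Real.exp Y * y ^ r ≤ K ^ r * 2 := h2
      _ ≤ K ^ r * 2 ^ r := by gcongr
      _ = _ := mul_comm _ _
  exact (Real.rpow_le_rpow_iff hy (by positivity) hr0).1 h3

theorem exists_norm_le_mul_abs {d : ℕ} (x : E d) (hx : x ≠ 0) :
    ∃ j, ‖x‖ ≤ (d + 1) * |x j| := by
  have hne : Nonempty (Fin d) := by
    by_contra h
    rw [not_nonempty_iff] at h
    exact hx (Subsingleton.elim _ _)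
  obtain ⟨j, hj⟩ := Finite.exists_max fun j => |x j|
  refine ⟨j, ?_⟩
  rw [EuclideanSpace.norm_eq]
  refine Real.sqrt_le_iff.2 ⟨by positivity, ?_⟩
  calc ∑ i, ‖x i‖ ^ 2 ≤ ∑ _i : Fin d, |x j| ^ 2 := by
        refine Finset.sum_le_sum fun i _ => ?_
        rw [Real.norm_eq_abs]
        have := hj i
        gcongr
    _ = d * |x j| ^ 2 := by simp
    _ ≤ ((d + 1) * |x j|) ^ 2 := by
        rw [mul_pow]
        gcongr
        nlinarith [(Nat.cast_nonneg d : (0 : ℝ) ≤ d)]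

/-- The largest coordinate controls the norm up to the factor `d + 1`. The bound `h0` covers `x =
0`, including `d = 0`, where there may be no coordinate to use. -/
theorem le_exp_norm_of_forall_coord {d : ℕ} {r ε K y : ℝ} (hr : 0 < r) (hε : 0 ≤ ε) (hK : 0 ≤ K)
    (x : E d) (h0 : y ≤ K) (h : ∀ j, y ≤ K * Real.exp (-ε * |x j| ^ r)) :
    y ≤ K * Real.exp (-(ε / ((d : ℝ) + 1) ^ r) * ‖x‖ ^ r) := by
  by_cases hx : x = 0
  · simpa [hx, Real.zero_rpow hr.ne'] using h0
  obtain ⟨j, hj⟩ := exists_norm_le_mul_abs x hx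
  refine (h j).trans (mul_le_mul_of_nonneg_left (Real.exp_le_exp.2 ?_) hK)
  rw [neg_mul, neg_mul, neg_le_neg_iff]
  have h1 : ‖x‖ ^ r ≤ ((d : ℝ) + 1) ^ r * |x j| ^ r := by
    rw [← Real.mul_rpow (by positivity) (by positivity)]
    exact Real.rpow_le_rpow (norm_nonneg _) hj hr.le
  have h2 : (0 : ℝ) < ((d : ℝ) + 1) ^ r := by positivity
  rw [div_mul_eq_mul_div, div_le_iff₀ h2]
  nlinarith

theorem rpow_add_le_two_rpow_mul {a b r : ℝ} (ha : 0 ≤ a) (hb : 0 ≤ b) (hr : 0 ≤ r) :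
    (a + b) ^ r ≤ 2 ^ r * (a ^ r + b ^ r) := by
  have h1 : a + b ≤ 2 * max a b := by
    rcases le_total a b with h | h
    · rw [max_eq_right h]; linarith
    · rw [max_eq_left h]; linarith
  refine (Real.rpow_le_rpow (by positivity) h1 hr).trans ?_
  rw [Real.mul_rpow (by norm_num) (by positivity)]
  gcongr
  have := Real.rpow_nonneg ha r
  have := Real.rpow_nonneg hb r
  rcases le_total a b with h | h
  · rw [max_eq_right h]; linarith
  · rw [max_eq_left h]; linarith

theorem continuous_exp_norm_rpow {d : ℕ} {r : ℝ} (hr : 0 ≤ r) (ε : ℝ) :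
    Continuous fun x : E d => Real.exp (ε * ‖x‖ ^ r) :=
  Real.continuous_exp.comp (continuous_const.mul (continuous_norm.rpow_const fun _ => Or.inr hr))

theorem integrable_exp_neg_norm_rpow {d : ℕ} {r ε : ℝ} (hr : 1 ≤ r) (hε : 0 < ε) :
    Integrable fun x : E d => Real.exp (-ε * ‖x‖ ^ r) := by
  have h1 : Integrable fun x : E d => (1 + ‖x‖) ^ (-((d : ℝ) + 1)) :=
    integrable_one_add_norm (by simp)
  refine (h1.const_mul (Real.exp (2 * ε) * (((d + 1).factorial : ℝ) / ε ^ (d + 1)))).mono'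
    (continuous_exp_norm_rpow (by linarith) _).aestronglyMeasurable
    (Filter.Eventually.of_forall fun x => ?_)
  rw [Real.norm_eq_abs, abs_of_pos (Real.exp_pos _)]
  have hx : ‖x‖ - 1 ≤ ‖x‖ ^ r := by
    rcases le_total 1 ‖x‖ with h | h
    · have := Real.rpow_le_rpow_of_exponent_le h hr
      rw [Real.rpow_one] at this
      linarith
    · have := Real.rpow_nonneg (norm_nonneg x) r
      linarith
  have h2 := Real.pow_div_factorial_le_exp (ε * (1 + ‖x‖)) (by positivity) (d + 1)
  have h3 : (1 + ‖x‖) ^ (-((d : ℝ) + 1)) = ((1 + ‖x‖) ^ (d + 1))⁻¹ := by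
    rw [Real.rpow_neg (by positivity)]
    congr 1
    exact_mod_cast Real.rpow_natCast (1 + ‖x‖) (d + 1)
  rw [h3]
  calc Real.exp (-ε * ‖x‖ ^ r) ≤ Real.exp (2 * ε - ε * (1 + ‖x‖)) := by
        gcongr
        nlinarith
    _ = Real.exp (2 * ε) * (Real.exp (ε * (1 + ‖x‖)))⁻¹ := by
        rw [sub_eq_add_neg, Real.exp_add, Real.exp_neg]
    _ ≤ Real.exp (2 * ε) * ((ε * (1 + ‖x‖)) ^ (d + 1) / (d + 1).factorial)⁻¹ := by
        have : 0 < (ε * (1 + ‖x‖)) ^ (d + 1) / ((d + 1).factorial : ℝ) := by positivity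
        gcongr
    _ = _ := by
        rw [mul_pow]
        field_simp

/-- An arbitrarily small share of the window's decay `|x|^r` absorbs the exponent `2π|x||η|` of the
Laplace kernel, at the price of `|η|^q`. -/
theorem young_scaled {r q : ℝ} (h : r.HolderConjugate q) {κ : ℝ} (hκ : 0 < κ) :
    ∃ D : ℝ, 0 < D ∧ ∀ a b : ℝ, 0 ≤ a → 0 ≤ b → 2 * Real.pi * (a * b) ≤ κ * a ^ r + D * b ^ q := by
  have hr := h.pos
  have hq := h.symm.pos
  have hpi := Real.pi_pos
  have hc : 0 < κ ^ (1 / r) := Real.rpow_pos_of_pos hκ _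
  refine ⟨(2 * Real.pi / κ ^ (1 / r)) ^ q, by positivity, fun a b ha hb => ?_⟩
  have hy := Real.young_inequality_of_nonneg (a := κ ^ (1 / r) * a)
    (b := 2 * Real.pi / κ ^ (1 / r) * b) (by positivity) (by positivity) h
  rw [Real.mul_rpow hc.le ha, Real.mul_rpow (by positivity) hb, ← Real.rpow_mul hκ.le,
    one_div_mul_cancel hr.ne', Real.rpow_one] at hy
  have h1 : κ * a ^ r / r ≤ κ * a ^ r := div_le_self (by positivity) h.lt.le
  have h2 : (2 * Real.pi / κ ^ (1 / r)) ^ q * b ^ q / q ≤ (2 * Real.pi / κ ^ (1 / r)) ^ q * b ^ q :=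
    div_le_self (by positivity) h.symm.lt.le
  have h3 : κ ^ (1 / r) * a * (2 * Real.pi / κ ^ (1 / r) * b) = 2 * Real.pi * (a * b) := by
    field_simp
  linarith

/-! ### Holomorphic parametric integrals -/

theorem differentiable_integral_of_dominated {X : Type*} [MeasurableSpace X] {μ : Measure X}
    {f : ℂ → X → ℂ} (hf : ∀ x, Differentiable ℂ fun w => f w x)
    (hm : ∀ w, AEStronglyMeasurable (f w) μ)
    (hb : ∀ R : ℝ, ∃ b : X → ℝ, Integrable b μ ∧ ∀ w, ‖w‖ ≤ R → ∀ x, ‖f w x‖ ≤ b x) :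
    Differentiable ℂ fun w => ∫ x, f w x ∂μ := by
  intro w₀
  -- Radius `‖w₀‖ + 2` leaves room for a unit circle around each point of the unit ball at `w₀`.
  -- Cauchy's estimate on it bounds the derivative by the same `b`.
  obtain ⟨b, hbi, hb⟩ := hb (‖w₀‖ + 2)
  have hd : ∀ x w, HasDerivAt (fun w => f w x) (deriv (fun w => f w x) w) w := fun x w =>
    (hf x w).hasDerivAt
  have hw : ∀ w ∈ Metric.ball w₀ 1, ∀ z ∈ Metric.closedBall w 1, ‖z‖ ≤ ‖w₀‖ + 2 := by
    intro w hw z hz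
    rw [mem_ball_iff_norm] at hw
    rw [mem_closedBall_iff_norm] at hz
    have h1 := norm_le_norm_add_norm_sub' z w
    have h2 := norm_le_norm_add_norm_sub' w w₀
    linarith
  refine (hasDerivAt_integral_of_dominated_loc_of_deriv_le (Metric.ball_mem_nhds w₀ one_pos)
    (Filter.Eventually.of_forall hm)
    (hbi.mono' (hm w₀) (Filter.Eventually.of_forall fun x => hb w₀ (by linarith) x))
    (F' := fun w x => deriv (fun w => f w x) w) ?_
    (Filter.Eventually.of_forall fun x w hwb => ?_) hbi
    (Filter.Eventually.of_forall fun x w _ => hd x w)).2.differentiableAt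
  · let u : ℕ → ℂ := fun n => ((1 / ((n : ℝ) + 1) : ℝ) : ℂ)
    have hu : Filter.Tendsto u Filter.atTop (nhdsWithin 0 {0}ᶜ) := by
      refine tendsto_nhdsWithin_iff.2 ⟨?_, Filter.Eventually.of_forall fun n => ?_⟩
      · have := (Complex.continuous_ofReal.tendsto 0).comp
          (tendsto_one_div_add_atTop_nhds_zero_nat (𝕜 := ℝ))
        rwa [Complex.ofReal_zero] at this
      · have : (1 / ((n : ℝ) + 1)) ≠ 0 := by positivity
        exact Complex.ofReal_ne_zero.2 this
    -- Measurability of the derivative in `x`: it is a pointwise limit of difference quotients along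
    -- `1/(n+1)`.
    refine aestronglyMeasurable_of_tendsto_ae (Filter.atTop)
      (f := fun n x => (u n)⁻¹ • (f (w₀ + u n) x - f w₀ x)) (fun n => ?_)
      (Filter.Eventually.of_forall fun x => ?_)
    · exact ((hm _).fun_sub (hm _)).fun_const_smul _
    · exact (hd x w₀).tendsto_slope_zero.comp hu
  · have := Complex.norm_deriv_le_of_forall_mem_sphere_norm_le one_pos
      (hf x).diffContOnCl (fun z hz => hb z (hw w hwb z (Metric.sphere_subset_closedBall hz)) x)
    simpa using this

/-! ### The Fourier-Laplace transform -/

/-- The vector of imaginary parts. -/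
noncomputable def imVec {d : ℕ} (ζ : Fin d → ℂ) : E d := WithLp.toLp 2 fun j => (ζ j).im

/-- The kernel `e^{-2πi x·ζ}`, `ζ ∈ ℂ^d`. -/
noncomputable def laplaceKernel {d : ℕ} (ζ : Fin d → ℂ) (x : E d) : ℂ :=
  Complex.exp (-2 * Real.pi * Complex.I * ∑ j, (x j : ℂ) * ζ j)

/-- The Fourier-Laplace transform `∫ f(x) e^{-2πi x·ζ} dx`, `ζ ∈ ℂ^d`. -/
noncomputable def fourierLaplace {d : ℕ} (f : E d → ℂ) (ζ : Fin d → ℂ) : ℂ :=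
  ∫ x, f x * laplaceKernel ζ x

theorem continuous_laplaceKernel {d : ℕ} :
    Continuous fun p : (Fin d → ℂ) × E d => laplaceKernel p.1 p.2 := by
  unfold laplaceKernel
  fun_prop

theorem norm_laplaceKernel {d : ℕ} (ζ : Fin d → ℂ) (x : E d) :
    ‖laplaceKernel ζ x‖ = Real.exp (2 * Real.pi * inner ℝ x (imVec ζ)) := by
  rw [laplaceKernel, Complex.norm_exp]
  congr 1
  have h : (-2 * (Real.pi : ℂ) * Complex.I * ∑ j, (x j : ℂ) * ζ j).re =
      2 * Real.pi * (∑ j, (x j : ℂ) * ζ j).im := by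
    simp
  rw [h, Complex.im_sum]
  congr 1
  simp only [Complex.im_ofReal_mul, PiLp.inner_apply, imVec, RCLike.inner_apply, conj_trivial]
  exact Finset.sum_congr rfl fun j _ => mul_comm _ _

theorem norm_laplaceKernel_le {d : ℕ} (ζ : Fin d → ℂ) (x : E d) :
    ‖laplaceKernel ζ x‖ ≤ Real.exp (2 * Real.pi * (‖x‖ * ‖imVec ζ‖)) := by
  rw [norm_laplaceKernel]
  have := real_inner_le_norm x (imVec ζ)
  have := Real.pi_pos
  gcongr

theorem continuous_imVec {d : ℕ} : Continuous (imVec : (Fin d → ℂ) → E d) := by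
  unfold imVec
  fun_prop

theorem norm_mul_laplaceKernel_le {d : ℕ} {r q ε D : ℝ}
    (hD : ∀ a b : ℝ, 0 ≤ a → 0 ≤ b → 2 * Real.pi * (a * b) ≤ ε / 2 * a ^ r + D * b ^ q)
    {f : E d → ℂ} {K : ℝ} (hK : 0 ≤ K) (hf : ∀ x, ‖f x‖ ≤ K * Real.exp (-ε * ‖x‖ ^ r))
    (ζ : Fin d → ℂ) (x : E d) :
    ‖f x * laplaceKernel ζ x‖ ≤
      K * Real.exp (D * ‖imVec ζ‖ ^ q) * Real.exp (-(ε / 2) * ‖x‖ ^ r) := by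
  rw [norm_mul]
  calc ‖f x‖ * ‖laplaceKernel ζ x‖
      ≤ (K * Real.exp (-ε * ‖x‖ ^ r)) *
          Real.exp (ε / 2 * ‖x‖ ^ r + D * ‖imVec ζ‖ ^ q) := by
        have h1 := norm_laplaceKernel_le ζ x
        have h2 := hD ‖x‖ ‖imVec ζ‖ (norm_nonneg _) (norm_nonneg _)
        have h3 := Real.exp_le_exp.2 h2
        exact mul_le_mul (hf x) (h1.trans h3) (norm_nonneg _) (by positivity)
    _ = _ := by
        rw [mul_assoc, mul_assoc, ← Real.exp_add, ← Real.exp_add]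
        ring_nf

section

variable {d : ℕ} {r q ε D K : ℝ} {f : E d → ℂ}

theorem aestronglyMeasurable_mul_laplaceKernel (hfm : Continuous f) (ζ : Fin d → ℂ) :
    AEStronglyMeasurable (fun x => f x * laplaceKernel ζ x) :=
  (hfm.mul (continuous_laplaceKernel.comp
    (continuous_const.prodMk continuous_id))).aestronglyMeasurable

theorem integrable_mul_laplaceKernel (hr : 1 ≤ r) (hε : 0 < ε)
    (hD : ∀ a b : ℝ, 0 ≤ a → 0 ≤ b → 2 * Real.pi * (a * b) ≤ ε / 2 * a ^ r + D * b ^ q)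
    (hK : 0 ≤ K) (hfm : Continuous f) (hf : ∀ x, ‖f x‖ ≤ K * Real.exp (-ε * ‖x‖ ^ r))
    (ζ : Fin d → ℂ) : Integrable fun x => f x * laplaceKernel ζ x :=
  ((integrable_exp_neg_norm_rpow hr (half_pos hε)).const_mul _).mono'
    (aestronglyMeasurable_mul_laplaceKernel hfm ζ)
    (Filter.Eventually.of_forall (norm_mul_laplaceKernel_le hD hK hf ζ))

theorem norm_fourierLaplace_le (hr : 1 ≤ r) (hε : 0 < ε)
    (hD : ∀ a b : ℝ, 0 ≤ a → 0 ≤ b → 2 * Real.pi * (a * b) ≤ ε / 2 * a ^ r + D * b ^ q)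
    (hK : 0 ≤ K) (hf : ∀ x, ‖f x‖ ≤ K * Real.exp (-ε * ‖x‖ ^ r)) (ζ : Fin d → ℂ) :
    ‖fourierLaplace f ζ‖ ≤ K * Real.exp (D * ‖imVec ζ‖ ^ q) *
      ∫ x : E d, Real.exp (-(ε / 2) * ‖x‖ ^ r) := by
  rw [← integral_const_mul]
  exact norm_integral_le_of_norm_le
    ((integrable_exp_neg_norm_rpow hr (half_pos hε)).const_mul _)
    (Filter.Eventually.of_forall (norm_mul_laplaceKernel_le hD hK hf ζ))

theorem continuous_fourierLaplace (hr : 1 ≤ r) (hq : 0 ≤ q) (hε : 0 < ε)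
    (hD : ∀ a b : ℝ, 0 ≤ a → 0 ≤ b → 2 * Real.pi * (a * b) ≤ ε / 2 * a ^ r + D * b ^ q)
    (hK : 0 ≤ K) (hfm : Continuous f) (hf : ∀ x, ‖f x‖ ≤ K * Real.exp (-ε * ‖x‖ ^ r)) :
    Continuous (fourierLaplace f) := by
  refine continuous_iff_continuousAt.2 fun ζ₀ => ?_
  have hc : Continuous fun ζ : Fin d → ℂ => Real.exp (D * ‖imVec ζ‖ ^ q) :=
    Real.continuous_exp.comp (continuous_const.mul
      (continuous_imVec.norm.rpow_const fun _ => Or.inr hq))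
  have hlt : ∀ᶠ ζ in nhds ζ₀, Real.exp (D * ‖imVec ζ‖ ^ q) <
      Real.exp (D * ‖imVec ζ₀‖ ^ q) + 1 :=
    hc.continuousAt.eventually_lt continuousAt_const (by linarith)
  refine continuousAt_of_dominated (bound := fun x => K * (Real.exp (D * ‖imVec ζ₀‖ ^ q) + 1) *
      Real.exp (-(ε / 2) * ‖x‖ ^ r))
    (Filter.Eventually.of_forall (aestronglyMeasurable_mul_laplaceKernel hfm))
    ?_ ((integrable_exp_neg_norm_rpow hr (half_pos hε)).const_mul _)
    (Filter.Eventually.of_forall fun x => ?_)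
  · filter_upwards [hlt] with ζ hζ
    refine Filter.Eventually.of_forall fun x => (norm_mul_laplaceKernel_le hD hK hf ζ x).trans ?_
    gcongr
  · exact (continuous_const.mul (continuous_laplaceKernel.comp
      (continuous_id.prodMk continuous_const))).continuousAt

theorem differentiable_fourierLaplace_line (hr : 1 ≤ r) (hq : 0 ≤ q) (hε : 0 < ε) (hD0 : 0 ≤ D)
    (hD : ∀ a b : ℝ, 0 ≤ a → 0 ≤ b → 2 * Real.pi * (a * b) ≤ ε / 2 * a ^ r + D * b ^ q)
    (hK : 0 ≤ K) (hfm : Continuous f) (hf : ∀ x, ‖f x‖ ≤ K * Real.exp (-ε * ‖x‖ ^ r))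
    (ζ η : Fin d → ℂ) : Differentiable ℂ fun w : ℂ => fourierLaplace f (ζ + w • η) := by
  refine differentiable_integral_of_dominated (fun x => ?_)
    (fun w => aestronglyMeasurable_mul_laplaceKernel hfm _) (fun R => ?_)
  · simp only [laplaceKernel, Pi.add_apply, Pi.smul_apply, smul_eq_mul]
    fun_prop
  · have hc : Continuous fun w : ℂ => imVec (ζ + w • η) := by
      have := continuous_imVec (d := d)
      fun_prop
    obtain ⟨S, hS⟩ := (isCompact_closedBall (0 : ℂ) R).exists_bound_of_continuousOn hc.continuousOn
    refine ⟨fun x => K * Real.exp (D * |S| ^ q) * Real.exp (-(ε / 2) * ‖x‖ ^ r),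
      (integrable_exp_neg_norm_rpow hr (half_pos hε)).const_mul _, fun w hw x =>
      (norm_mul_laplaceKernel_le hD hK hf _ x).trans ?_⟩
    have : ‖imVec (ζ + w • η)‖ ≤ |S| := (hS w (by simpa using hw)).trans (le_abs_self S)
    beta_reduce
    gcongr

end

/-- The Fourier-Laplace transform of a partial derivative. -/
theorem fourierLaplace_lineDeriv {d : ℕ} {r q ε D K K' : ℝ} (hr : 1 ≤ r) (hε : 0 < ε)
    (hD : ∀ a b : ℝ, 0 ≤ a → 0 ≤ b → 2 * Real.pi * (a * b) ≤ ε / 2 * a ^ r + D * b ^ q)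
    (hK : 0 ≤ K) (hK' : 0 ≤ K') (f : 𝓢(E d, ℂ)) (j : Fin d)
    (hf : ∀ x, ‖f x‖ ≤ K * Real.exp (-ε * ‖x‖ ^ r))
    (hf' : ∀ x, ‖(∂_{EuclideanSpace.single j (1 : ℝ)} f : 𝓢(E d, ℂ)) x‖ ≤
      K' * Real.exp (-ε * ‖x‖ ^ r)) (ζ : Fin d → ℂ) :
    fourierLaplace (∂_{EuclideanSpace.single j (1 : ℝ)} f : 𝓢(E d, ℂ)) ζ =
      2 * Real.pi * Complex.I * ζ j * fourierLaplace f ζ := by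
  have hk : ∀ x, HasFDerivAt (laplaceKernel ζ)
      (laplaceKernel ζ x • ((-2 * Real.pi * Complex.I) • ∑ i, (EuclideanSpace.proj (𝕜 := ℝ) i :
        E d →L[ℝ] ℝ).smulRight (ζ i))) x := by
    intro x
    have h1 : HasFDerivAt (fun x : E d => ∑ i, (x i : ℂ) * ζ i)
        (∑ i, (EuclideanSpace.proj (𝕜 := ℝ) i : E d →L[ℝ] ℝ).smulRight (ζ i)) x := by
      refine HasFDerivAt.fun_sum fun i _ => ?_
      have := ((EuclideanSpace.proj (𝕜 := ℝ) i : E d →L[ℝ] ℝ).smulRight (ζ i)).hasFDerivAt (x := x)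
      simpa using! this
    exact (h1.const_mul _).cexp
  have hkd : ∀ x, fderiv ℝ (laplaceKernel ζ) x (EuclideanSpace.single j (1 : ℝ)) =
      -2 * Real.pi * Complex.I * ζ j * laplaceKernel ζ x := by
    intro x
    rw [(hk x).fderiv]
    simp
    ring
  have hfd : ∀ x, fderiv ℝ f x (EuclideanSpace.single j (1 : ℝ)) =
      (∂_{EuclideanSpace.single j (1 : ℝ)} f : 𝓢(E d, ℂ)) x := fun x => by
    rw [SchwartzMap.lineDerivOp_apply_eq_fderiv]
  have hi := integrable_mul_laplaceKernel hr hε hD hK f.continuous hf ζ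
  have hi' := integrable_mul_laplaceKernel hr hε hD hK'
    (∂_{EuclideanSpace.single j (1 : ℝ)} f : 𝓢(E d, ℂ)).continuous hf' ζ
  have h := integral_mul_fderiv_eq_neg_fderiv_mul_of_integrable (𝕜 := ℂ) (μ := volume)
    (f := f) (g := laplaceKernel ζ) (v := EuclideanSpace.single j (1 : ℝ))
    (by simpa only [hfd] using hi')
    (by simp only [hkd, mul_left_comm _ (-2 * Real.pi * Complex.I * ζ j)]; exact hi.const_mul _) hi
    (fun x _ => f.differentiableAt) (fun x _ => (hk x).differentiableAt)
  simp only [hkd, hfd, mul_left_comm _ (-2 * Real.pi * Complex.I * ζ j), integral_const_mul] at h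
  rw [fourierLaplace, fourierLaplace, ← neg_eq_iff_eq_neg.2 h]
  ring

/-! ### Gelfand-Shilov functions: decay and Fourier-Laplace transform. -/

/-- Powers of a single `ζ_j` suffice for decay on the Fourier side, so only pure derivatives are
needed. -/
theorem multiDeriv_single {d : ℕ} (j : Fin d) (n : ℕ) (f : 𝓢(E d, ℂ)) :
    multiDeriv (Pi.single j n) f =
      (fun k : 𝓢(E d, ℂ) => ∂_{EuclideanSpace.single j (1 : ℝ)} k)^[n] f := by
  have key : ∀ l : List (Fin d), l.Nodup → l.foldr
      (fun i h => (fun k : 𝓢(E d, ℂ) => ∂_{EuclideanSpace.single i (1 : ℝ)} k)^[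
        (Pi.single j n : Fin d → ℕ) i] h) f =
      if j ∈ l then (fun k : 𝓢(E d, ℂ) => ∂_{EuclideanSpace.single j (1 : ℝ)} k)^[n] f else f := by
    intro l
    induction l with
    | nil => simp
    | cons a l ih =>
      intro hl
      rw [List.nodup_cons] at hl
      rw [List.foldr_cons, ih hl.2]
      by_cases ha : a = j
      · subst ha
        simp [hl.1]
      · simp [ha, Ne.symm ha]
  rw [multiDeriv, key _ (List.nodup_finRange d), if_pos (List.mem_finRange j)]

/-- Exponential decay of the pure partial derivatives of a Gelfand-Shilov function. -/
theorem GelfandShilov.exists_decay {d : ℕ} {r : ℝ} (hr : 1 ≤ r) {g : 𝓢(E d, ℂ)}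
    (hg : GelfandShilov (1 / r) (1 / r) g) :
    ∃ K B ε : ℝ, 0 < K ∧ 0 < B ∧ 0 < ε ∧
      (∀ x, ‖g x‖ ≤ K * Real.exp (-ε * ‖x‖ ^ r)) ∧
      ∀ (j : Fin d) (n : ℕ) (x : E d),
      ‖((fun k : 𝓢(E d, ℂ) => ∂_{EuclideanSpace.single j (1 : ℝ)} k)^[n] g) x‖ ≤
        K * (B ^ n * (n.factorial : ℝ) ^ (1 / r)) * Real.exp (-ε * ‖x‖ ^ r) := by
  obtain ⟨A, B, C, hA, hB, hC, h⟩ := hg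
  have hr0 : 0 < r := by linarith
  have hAr : 0 < A ^ r := Real.rpow_pos_of_pos hA r
  have hprod : ∀ (i : Fin d) (n : ℕ) (F : Fin d → ℕ → ℝ), (∀ k, F k 0 = 1) →
      ∏ k, F k ((Pi.single i n : Fin d → ℕ) k) = F i n := by
    intro i n F hF
    rw [Finset.prod_eq_single i]
    · simp
    · intro k _ hk
      rw [Pi.single_eq_of_ne hk, hF]
    · simp
  have key : ∀ (β : Fin d → ℕ) (x : E d), ‖multiDeriv β g x‖ ≤
      2 * (C * (B ^ (∑ i, β i) * (∏ i, (Nat.factorial (β i) : ℝ)) ^ (1 / r))) *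
        Real.exp (-((2 * r * A ^ r)⁻¹ / ((d : ℝ) + 1) ^ r) * ‖x‖ ^ r) := by
    intro β x
    refine le_exp_norm_of_forall_coord hr0 (by positivity) (by positivity) x ?_ fun i => ?_
    · have := h 0 β x
      simp only [Pi.zero_apply, pow_zero, Finset.prod_const_one, abs_one, one_mul,
        Finset.sum_const_zero, Nat.factorial_zero, Nat.cast_one, Real.one_rpow] at this
      have h0 : 0 ≤ C * (B ^ (∑ i, β i) * (∏ i, (Nat.factorial (β i) : ℝ)) ^ (1 / r)) := by
        positivity
      linarith
    · refine le_exp_of_forall_pow_mul_le hr hA (abs_nonneg _) (norm_nonneg _) (by positivity)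
        fun n => ?_
      have := h (Pi.single i n) β x
      rw [hprod i n (fun k a => x k ^ a) (by simp),
        hprod i n (fun _ a => (Nat.factorial a : ℝ)) (by simp), Finset.sum_pi_single' i n Finset.univ,
        if_pos (Finset.mem_univ i), abs_pow] at this
      refine this.trans (le_of_eq ?_)
      ring
  refine ⟨2 * C, B, (2 * r * A ^ r)⁻¹ / ((d : ℝ) + 1) ^ r, by positivity, hB, by positivity,
    fun x => ?_, fun j n x => ?_⟩
  · have h0 := key 0 x
    have hz : multiDeriv 0 g = g := by
      have : ∀ l : List (Fin d), l.foldr (fun i h => (fun k : 𝓢(E d, ℂ) =>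
          ∂_{EuclideanSpace.single i (1 : ℝ)} k)^[(0 : Fin d → ℕ) i] h) g = g := by
        intro l
        induction l with
        | nil => rfl
        | cons a l ih => rw [List.foldr_cons, ih]; rfl
      exact this _
    rw [hz] at h0
    simpa using h0
  · have h0 := key (Pi.single j n) x
    rw [multiDeriv_single, hprod j n (fun _ a => (Nat.factorial a : ℝ)) (by simp),
      Finset.sum_pi_single' j n Finset.univ, if_pos (Finset.mem_univ j)] at h0
    refine h0.trans (le_of_eq ?_)
    ring

/-- The vector `ξ + iη`. -/
noncomputable def cplx {d : ℕ} (ξ η : E d) : Fin d → ℂ := fun j => (ξ j : ℂ) + Complex.I * (η j : ℂ)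

theorem imVec_cplx {d : ℕ} (ξ η : E d) : imVec (cplx ξ η) = η := by
  ext j; simp [imVec, cplx]

theorem abs_le_norm_cplx {d : ℕ} (ξ η : E d) (j : Fin d) : |ξ j| ≤ ‖cplx ξ η j‖ := by
  have := Complex.abs_re_le_norm (cplx ξ η j)
  simpa [cplx] using this

/-- The Fourier-Laplace transform of a Gelfand-Shilov function decays along `ℝ^d` and has
controlled growth along `iℝ^d`. -/
theorem GelfandShilov.exists_fourierLaplace_bound {d : ℕ} {r q : ℝ} (hrq : r.HolderConjugate q)
    {g : 𝓢(E d, ℂ)} (hg : GelfandShilov (1 / r) (1 / r) g) :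
    ∃ K ε D : ℝ, 0 < K ∧ 0 < ε ∧ 0 < D ∧ ∀ ξ η : E d, ‖fourierLaplace g (cplx ξ η)‖ ≤
      K * Real.exp (-ε * ‖ξ‖ ^ r) * Real.exp (D * ‖η‖ ^ q) := by
  have hr := hrq.lt.le
  have hr0 : 0 < r := hrq.pos
  obtain ⟨K, B, ε, hK, hB, hε, hg0, hgn⟩ := hg.exists_decay hr
  obtain ⟨D, hD0, hD⟩ := young_scaled hrq (half_pos hε)
  set I := ∫ x : E d, Real.exp (-(ε / 2) * ‖x‖ ^ r) with hI
  have hI0 : 0 ≤ I := integral_nonneg fun x => (Real.exp_pos _).le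
  have hBr : 0 < B ^ r := Real.rpow_pos_of_pos hB r
  -- The `+ 1` gives strict positivity from `0 ≤ I` alone.
  refine ⟨2 * (K * I) + 1, (2 * r * B ^ r)⁻¹ / ((d : ℝ) + 1) ^ r, D, by positivity, by positivity,
    hD0, fun ξ η => ?_⟩
  -- Derivatives become powers of `2πiζ_j`, and `|ξ_j| ≤ |2πζ_j|`. The derivative bounds on `g` are
  -- thus factorial moment bounds in `ξ_j` for its transform.
  have hmom : ∀ (j : Fin d) (n : ℕ),
      fourierLaplace ((fun k : 𝓢(E d, ℂ) => ∂_{EuclideanSpace.single j (1 : ℝ)} k)^[n] g)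
        (cplx ξ η) = (2 * Real.pi * Complex.I * cplx ξ η j) ^ n * fourierLaplace g (cplx ξ η) := by
    intro j n
    induction n with
    | zero => simp
    | succ n ih =>
      have hn := hgn j (n + 1)
      rw [Function.iterate_succ_apply'] at hn ⊢
      rw [fourierLaplace_lineDeriv hr hε hD (by positivity) (by positivity) _ j (hgn j n) hn, ih]
      ring
  have hb : ‖fourierLaplace g (cplx ξ η)‖ ≤ (2 * (K * Real.exp (D * ‖η‖ ^ q) * I)) *
      Real.exp (-((2 * r * B ^ r)⁻¹ / ((d : ℝ) + 1) ^ r) * ‖ξ‖ ^ r) := by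
    refine le_exp_norm_of_forall_coord hr0 (by positivity) (by positivity) ξ ?_ fun j => ?_
    · have := norm_fourierLaplace_le hr hε hD hK.le hg0 (cplx ξ η)
      rw [imVec_cplx] at this
      have h0 : 0 ≤ K * Real.exp (D * ‖η‖ ^ q) * I := by positivity
      linarith
    · refine le_exp_of_forall_pow_mul_le hr hB (abs_nonneg _) (norm_nonneg _) (by positivity)
        fun n => ?_
      have h1 := norm_fourierLaplace_le hr hε hD (by positivity) (hgn j n) (cplx ξ η)
      rw [imVec_cplx, hmom, norm_mul, norm_pow] at h1
      have h2 : |ξ j| ≤ ‖2 * Real.pi * Complex.I * cplx ξ η j‖ := by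
        have h3 := abs_le_norm_cplx ξ η j
        have h4 : ‖2 * (Real.pi : ℂ) * Complex.I * cplx ξ η j‖ = 2 * Real.pi * ‖cplx ξ η j‖ := by
          simp [abs_of_pos Real.pi_pos]
        rw [h4]
        nlinarith [Real.pi_gt_three, norm_nonneg (cplx ξ η j)]
      calc |ξ j| ^ n * ‖fourierLaplace g (cplx ξ η)‖
          ≤ ‖2 * Real.pi * Complex.I * cplx ξ η j‖ ^ n * ‖fourierLaplace g (cplx ξ η)‖ := by gcongr
        _ ≤ _ := h1
        _ = _ := by ring
  refine hb.trans ?_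
  have h5 : 0 ≤ Real.exp (-((2 * r * B ^ r)⁻¹ / ((d : ℝ) + 1) ^ r) * ‖ξ‖ ^ r) *
    Real.exp (D * ‖η‖ ^ q) := by positivity
  nlinarith

/-! ### Shifting the domain of integration into the complex domain -/

theorem cplx_zero_add_smul {d : ℕ} (ξ η : E d) (w : ℂ) :
    cplx ξ 0 + w • cplx η 0 = cplx (ξ + w.re • η) (w.im • η) := by
  funext j
  apply Complex.ext <;> simp [cplx]

theorem continuous_cplx {d : ℕ} : Continuous fun p : E d × E d => cplx p.1 p.2 := by
  unfold cplx
  fun_prop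

/-- Put `G(w) = ∫ F(ξ + wη) dξ`, an entire function of one variable. For real `w` it is constant by
translation invariance of Lebesgue measure, so it is constant by the identity theorem, and `w = i`
gives the claim. The real shift `v` in the domination accounts for `Re w`. -/
theorem integral_cplx_zero_eq {d : ℕ} {F : (Fin d → ℂ) → ℂ} (hc : Continuous F)
    (hd : ∀ ζ η : Fin d → ℂ, Differentiable ℂ fun w : ℂ => F (ζ + w • η))
    (hb : ∀ R : ℝ, ∃ b : E d → ℝ, Integrable b ∧ ∀ ξ v η : E d, ‖v‖ ≤ R → ‖η‖ ≤ R →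
      ‖F (cplx (ξ + v) η)‖ ≤ b ξ) (η : E d) :
    ∫ ξ, F (cplx ξ 0) = ∫ ξ, F (cplx ξ η) := by
  let G : ℂ → ℂ := fun w => ∫ ξ, F (cplx ξ 0 + w • cplx η 0)
  have hG : Differentiable ℂ G := by
    refine differentiable_integral_of_dominated (fun ξ => hd _ _) (fun w => ?_) (fun R => ?_)
    · have h0 : Continuous fun ξ : E d => cplx ξ (0 : E d) :=
        continuous_cplx.comp (continuous_id.prodMk continuous_const)
      exact (hc.comp (h0.add continuous_const)).aestronglyMeasurable
    · obtain ⟨b, hbi, hb⟩ := hb (R * ‖η‖)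
      refine ⟨b, hbi, fun w hw ξ => ?_⟩
      rw [cplx_zero_add_smul]
      refine hb _ _ _ ?_ ?_
      · rw [norm_smul]
        have := (Complex.abs_re_le_norm w).trans hw
        exact mul_le_mul_of_nonneg_right this (norm_nonneg _)
      · rw [norm_smul]
        have := (Complex.abs_im_le_norm w).trans hw
        exact mul_le_mul_of_nonneg_right this (norm_nonneg _)
  have hreal : ∀ s : ℝ, G s = G 0 := by
    intro s
    simp only [G, cplx_zero_add_smul, Complex.ofReal_re, Complex.ofReal_im, zero_smul,
      Complex.zero_re, Complex.zero_im, add_zero]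
    exact integral_add_right_eq_self (fun ξ => F (cplx ξ 0)) (s • η)
  have hconst : G = fun _ => G 0 := by
    refine AnalyticOnNhd.eq_of_frequently_eq (z₀ := 0)
      (hG.differentiableOn.analyticOnNhd isOpen_univ) analyticOnNhd_const ?_
    have hu : Filter.Tendsto (fun n : ℕ => ((1 / ((n : ℝ) + 1) : ℝ) : ℂ)) Filter.atTop
        (nhdsWithin 0 {0}ᶜ) := by
      refine tendsto_nhdsWithin_iff.2 ⟨?_, Filter.Eventually.of_forall fun n => ?_⟩
      · have := (Complex.continuous_ofReal.tendsto 0).comp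
          (tendsto_one_div_add_atTop_nhds_zero_nat (𝕜 := ℝ))
        rwa [Complex.ofReal_zero] at this
      · have : (1 / ((n : ℝ) + 1)) ≠ 0 := by positivity
        exact Complex.ofReal_ne_zero.2 this
    exact hu.frequently (Filter.Frequently.of_forall fun n => hreal _)
  have h1 := congrFun hconst Complex.I
  simp only [G, cplx_zero_add_smul, Complex.I_re, Complex.I_im, zero_smul, one_smul,
      Complex.zero_re, Complex.zero_im, add_zero] at h1
  exact h1.symm

/-! ### Fourier transforms of time-frequency shifts -/

/-- The conjugate of a transform is antiholomorphic in `ζ`. The left side is its holomorphic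
replacement: it agrees with that conjugate on `ℝ^d` and has the same size at `ξ + iη` as the
original at `ξ - iη`. -/
theorem fourierLaplace_conj {d : ℕ} (f : E d → ℂ) (ξ η : E d) :
    fourierLaplace (fun x => (starRingEnd ℂ) (f x)) (-cplx ξ η) =
      (starRingEnd ℂ) (fourierLaplace f (cplx ξ (-η))) := by
  rw [fourierLaplace, fourierLaplace, ← integral_conj]
  refine integral_congr_ae (Filter.Eventually.of_forall fun x => ?_)
  simp only [map_mul, laplaceKernel, ← Complex.exp_conj, map_sum, Complex.conj_ofReal, map_neg,
    Complex.conj_I, cplx, Pi.neg_apply, map_add, Complex.conj_ofNat, PiLp.neg_apply,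
    Complex.ofReal_neg, mul_neg, Finset.sum_neg_distrib, neg_mul, neg_neg]

theorem conj_laplaceKernel {d : ℕ} (ξ x : E d) :
    (starRingEnd ℂ) (laplaceKernel (cplx ξ 0) x) = laplaceKernel (cplx ξ 0) (-x) := by
  simp only [laplaceKernel, ← Complex.exp_conj, map_mul, map_sum, Complex.conj_ofReal, map_neg,
    Complex.conj_I, cplx, Complex.conj_ofNat, PiLp.neg_apply, PiLp.zero_apply,
    Complex.ofReal_neg, mul_neg, Finset.sum_neg_distrib, neg_mul, neg_neg, Complex.ofReal_zero,
    mul_zero, add_zero]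

theorem fourier_timeFreqShift {d : ℕ} (z : Phase d) (f : E d → ℂ) (ξ : E d) :
    𝓕 (timeFreqShift z f) ξ =
      laplaceKernel (cplx (ξ - z.snd) 0) z.fst * fourierLaplace f (cplx (ξ - z.snd) 0) := by
  rw [Real.fourier_eq', fourierLaplace, ← integral_const_mul,
    ← integral_add_right_eq_self _ z.fst]
  refine integral_congr_ae (Filter.Eventually.of_forall fun x => ?_)
  simp only [smul_eq_mul, timeFreqShift, add_sub_cancel_right]
  have hk : ∀ y : E d, laplaceKernel (cplx (ξ - z.snd) 0) y =
      Complex.exp (((-2 * Real.pi * inner ℝ y (ξ - z.snd) : ℝ) : ℂ) * Complex.I) := by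
    intro y
    simp only [laplaceKernel, cplx, PiLp.inner_apply, RCLike.inner_apply, conj_trivial,
      PiLp.zero_apply, Complex.ofReal_zero, mul_zero, add_zero]
    push_cast
    simp only [mul_comm (y _ : ℂ)]
    ring_nf
  rw [hk, hk, ← mul_assoc, ← Complex.exp_add, mul_left_comm, ← Complex.exp_add, mul_comm (f x)]
  congr 2
  rw [inner_sub_right, inner_sub_right, real_inner_comm (x + z.fst) z.snd, inner_add_left,
    inner_add_left]
  push_cast
  ring

theorem continuous_timeFreqShift {d : ℕ} (z : Phase d) {f : E d → ℂ} (hf : Continuous f) :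
    Continuous (timeFreqShift z f) := by
  unfold timeFreqShift
  fun_prop

theorem norm_timeFreqShift {d : ℕ} (z : Phase d) (f : E d → ℂ) (y : E d) :
    ‖timeFreqShift z f y‖ = ‖f (y - z.fst)‖ := by
  rw [timeFreqShift, norm_mul, Complex.norm_exp]
  simp

theorem integrable_timeFreqShift {d : ℕ} (z : Phase d) (f : 𝓢(E d, ℂ)) :
    Integrable (timeFreqShift z f) := by
  refine (f.integrable.comp_sub_right z.fst).mono
    (continuous_timeFreqShift z f.continuous).aestronglyMeasurable
    (Filter.Eventually.of_forall fun y => (norm_timeFreqShift z f y).le)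

theorem continuous_fourierInv {d : ℕ} {G : E d → ℂ} (hG : Integrable G) : Continuous (𝓕⁻ G) :=
  VectorFourier.fourierIntegral_continuous Real.continuous_fourierChar
    (by simpa only [LinearMap.neg_apply, innerₗ_apply_apply] using
      (continuous_inner (𝕜 := ℝ) (E := E d)).fun_neg) hG

theorem norm_fourierInv_le {d : ℕ} (G : E d → ℂ) (x : E d) : ‖𝓕⁻ G x‖ ≤ ∫ ξ, ‖G ξ‖ :=
  VectorFourier.norm_fourierIntegral_le_integral_norm _ _ _ _ _

/-- Parseval's identity. -/
theorem bracket_fourierInv {d : ℕ} {G f : E d → ℂ} (hG : Integrable G) (hf : Integrable f) :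
    bracket (𝓕⁻ G) f = ∫ ξ, G ξ * (starRingEnd ℂ) (𝓕 f ξ) := by
  have hfc : Integrable fun x => (starRingEnd ℂ) (f x) :=
    (Complex.conjLIE.integrable_comp_iff (φ := f)).2 hf
  have h := VectorFourier.integral_fourierIntegral_smul_eq_flip (L := -innerₗ (E d))
    (μ := volume) (ν := volume) Real.continuous_fourierChar
    (by simpa only [LinearMap.neg_apply, innerₗ_apply_apply] using
      (continuous_inner (𝕜 := ℝ) (E := E d)).fun_neg) hG hfc
  simp only [smul_eq_mul] at h
  refine Eq.trans h (integral_congr_ae (Filter.Eventually.of_forall fun ξ => ?_))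
  have h2 : VectorFourier.fourierIntegral Real.fourierChar volume (-innerₗ (E d)).flip
      (fun x => (starRingEnd ℂ) (f x)) ξ = (starRingEnd ℂ) (𝓕 f ξ) := by
    rw [Real.fourier_eq, ← integral_conj]
    refine integral_congr_ae (Filter.Eventually.of_forall fun x => ?_)
    simp only [Circle.smul_def, smul_eq_mul, map_mul, ← Circle.coe_inv_eq_conj, ← AddChar.map_neg_eq_inv]
    simp [real_inner_comm]
  simp only [h2]

/-! ### Decay of the Gabor matrix of a multiplier with entire symbol -/

theorem exists_norm_eq_inner_eq {d : ℕ} (u : E d) {δ r : ℝ} (hδ : 0 ≤ δ) (hr : 1 < r) :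
    ∃ η : E d, ‖η‖ = δ * ‖u‖ ^ (r - 1) ∧ inner ℝ u η = δ * ‖u‖ ^ r := by
  by_cases hu : u = 0
  · exact ⟨0, by simp [hu, Real.zero_rpow (by linarith : r - 1 ≠ 0)],
      by simp [hu, Real.zero_rpow (by linarith : r ≠ 0)]⟩
  have hu' : 0 < ‖u‖ := norm_pos_iff.2 hu
  have h1 : ‖u‖ ^ r = ‖u‖ ^ (r - 1) * ‖u‖ := by
    rw [← Real.rpow_add_one hu'.ne']; ring_nf
  refine ⟨(δ * ‖u‖ ^ (r - 1) / ‖u‖) • u, ?_, ?_⟩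
  · rw [norm_smul, Real.norm_eq_abs, abs_of_nonneg (by positivity)]
    field_simp
  · rw [inner_smul_right, real_inner_self_eq_norm_sq, h1]
    field_simp

/-- Choice of the contour: the linear gain beats the growth of the symbol and the window. -/
theorem exists_contour {d : ℕ} {r q ν : ℝ} (hrq : r.HolderConjugate q) (hq : 2 ≤ q)
    (hνq : ν ≤ q) {D₁ D₂ : ℝ} (hD₁ : 0 ≤ D₁) (hD₂ : 0 ≤ D₂) :
    ∃ δ c : ℝ, 0 < δ ∧ ∀ u : E d, ∃ η : E d,
      D₁ * (1 + ‖η‖) ^ ν + D₂ * ‖η‖ ^ q - 2 * Real.pi * inner ℝ u η ≤ c - δ * ‖u‖ ^ r := by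
  set D := D₁ * 2 ^ q + D₂ with hD
  have hD0 : 0 ≤ D := by positivity
  -- As `q ≥ 2` and `δ ≤ 1`, the loss is at most `Dδ²‖u‖^r ≤ δ‖u‖^r`. The gain is `2πδ‖u‖^r ≥
  -- 2δ‖u‖^r`, so `δ‖u‖^r` remains.
  refine ⟨1 / (1 + D), D₁ * 2 ^ q, by positivity, fun u => ?_⟩
  obtain ⟨η, hη, hin⟩ := exists_norm_eq_inner_eq u (δ := 1 / (1 + D)) (by positivity) hrq.lt
  refine ⟨η, ?_⟩
  set δ := 1 / (1 + D) with hδ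
  have hδ0 : 0 < δ := by positivity
  have hδ1 : δ ≤ 1 := by
    rw [hδ, div_le_one (by positivity)]; linarith
  have hDδ : D * δ ≤ 1 := by
    rw [hδ, mul_one_div, div_le_one (by positivity)]; linarith
  have h1 : (1 + ‖η‖) ^ ν ≤ 2 ^ q * (1 + ‖η‖ ^ q) := by
    have := norm_nonneg η
    calc (1 + ‖η‖) ^ ν ≤ (1 + ‖η‖) ^ q := Real.rpow_le_rpow_of_exponent_le (by linarith) hνq
      _ ≤ 2 ^ q * (1 ^ q + ‖η‖ ^ q) := rpow_add_le_two_rpow_mul zero_le_one this (by linarith)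
      _ = _ := by rw [Real.one_rpow]
  have h2 : ‖η‖ ^ q ≤ δ ^ 2 * ‖u‖ ^ r := by
    rw [hη, Real.mul_rpow hδ0.le (by positivity), ← Real.rpow_mul (norm_nonneg _),
      hrq.sub_one_mul_conj]
    have : δ ^ q ≤ δ ^ (2 : ℝ) := Real.rpow_le_rpow_of_exponent_ge hδ0 hδ1 hq
    rw [Real.rpow_two] at this
    gcongr
  have hur : 0 ≤ ‖u‖ ^ r := by positivity
  have hpi := Real.pi_gt_three
  rw [hin]
  have h3 : D * ‖η‖ ^ q ≤ δ * ‖u‖ ^ r := by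
    calc D * ‖η‖ ^ q ≤ D * (δ ^ 2 * ‖u‖ ^ r) := by gcongr
      _ = (D * δ) * (δ * ‖u‖ ^ r) := by ring
      _ ≤ 1 * (δ * ‖u‖ ^ r) := by gcongr
      _ = _ := one_mul _
  have h4 : D₁ * (1 + ‖η‖) ^ ν ≤ D₁ * (2 ^ q * (1 + ‖η‖ ^ q)) := by gcongr
  have h5 : D₁ * (2 ^ q * (1 + ‖η‖ ^ q)) + D₂ * ‖η‖ ^ q = D₁ * 2 ^ q + D * ‖η‖ ^ q := by
    rw [hD]; ring
  have h6 : 0 ≤ δ * ‖u‖ ^ r := by positivity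
  nlinarith

theorem norm_sub_rpow_le {d : ℕ} {r : ℝ} (hr : 0 ≤ r) (x y z : E d) :
    ‖x - y‖ ^ r ≤ 2 ^ r * (‖z - x‖ ^ r + ‖z - y‖ ^ r) := by
  have h : ‖x - y‖ ≤ ‖z - x‖ + ‖z - y‖ := by
    have := norm_sub_le (z - y) (z - x)
    rw [sub_sub_sub_cancel_left] at this
    linarith
  exact (Real.rpow_le_rpow (norm_nonneg _) h hr).trans
    (rpow_add_le_two_rpow_mul (norm_nonneg _) (norm_nonneg _) hr)

/-- The integrand of the Gabor matrix, as a function on `ℂ^d`. -/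
noncomputable def gaborIntegrand {d : ℕ} (S : (Fin d → ℂ) → ℂ) (g : E d → ℂ) (z w : Phase d)
    (ζ : Fin d → ℂ) : ℂ :=
  S ζ * (laplaceKernel (ζ - cplx z.snd 0) z.fst * fourierLaplace g (ζ - cplx z.snd 0)) *
    (laplaceKernel (ζ - cplx w.snd 0) (-w.fst) *
      fourierLaplace (fun x => (starRingEnd ℂ) (g x)) (-(ζ - cplx w.snd 0)))

theorem cplx_sub {d : ℕ} (ξ η y : E d) : cplx ξ η - cplx y 0 = cplx (ξ - y) η := by
  funext j
  simp only [cplx, Pi.sub_apply, PiLp.sub_apply, PiLp.zero_apply]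
  push_cast
  ring

theorem gaborIntegrand_real {d : ℕ} (S : (Fin d → ℂ) → ℂ) (g : E d → ℂ) (z w : Phase d)
    (ξ : E d) : gaborIntegrand S g z w (cplx ξ 0) =
      S (cplx ξ 0) * 𝓕 (timeFreqShift z g) ξ * (starRingEnd ℂ) (𝓕 (timeFreqShift w g) ξ) := by
  simp only [gaborIntegrand, cplx_sub, fourier_timeFreqShift, map_mul, conj_laplaceKernel,
    fourierLaplace_conj, neg_zero]

theorem norm_gaborIntegrand_le {d : ℕ} {r q ν CS DS K ε D : ℝ} (hCS : 0 ≤ CS) (hK : 0 ≤ K)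
    {S : (Fin d → ℂ) → ℂ}
    (hS : ∀ ξ η : E d, ‖S (cplx ξ η)‖ ≤ CS * Real.exp (DS * (1 + ‖η‖) ^ ν)) {g : E d → ℂ}
    (hg : ∀ ξ η : E d, ‖fourierLaplace g (cplx ξ η)‖ ≤
      K * Real.exp (-ε * ‖ξ‖ ^ r) * Real.exp (D * ‖η‖ ^ q)) (z w : Phase d) (ξ η : E d) :
    ‖gaborIntegrand S g z w (cplx ξ η)‖ ≤ CS * K ^ 2 *
      Real.exp (DS * (1 + ‖η‖) ^ ν + 2 * D * ‖η‖ ^ q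
        - 2 * Real.pi * inner ℝ (w.fst - z.fst) η) *
      Real.exp (-ε * ‖ξ - z.snd‖ ^ r - ε * ‖ξ - w.snd‖ ^ r) := by
  have h1 := hg (ξ - z.snd) η
  have h2 := hg (ξ - w.snd) (-η)
  rw [norm_neg] at h2
  rw [gaborIntegrand, cplx_sub, cplx_sub, fourierLaplace_conj, norm_mul, norm_mul, norm_mul,
    norm_mul, norm_laplaceKernel, norm_laplaceKernel, imVec_cplx, imVec_cplx, RCLike.norm_conj]
  calc _ ≤ (CS * Real.exp (DS * (1 + ‖η‖) ^ ν)) * (Real.exp (2 * Real.pi * inner ℝ z.fst η) *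
        (K * Real.exp (-ε * ‖ξ - z.snd‖ ^ r) * Real.exp (D * ‖η‖ ^ q))) *
        (Real.exp (2 * Real.pi * inner ℝ (-w.fst) η) *
        (K * Real.exp (-ε * ‖ξ - w.snd‖ ^ r) * Real.exp (D * ‖η‖ ^ q))) := by
        have := hS ξ η
        gcongr
    _ = CS * K ^ 2 * (Real.exp (DS * (1 + ‖η‖) ^ ν) * Real.exp (2 * Real.pi * inner ℝ z.fst η) *
        Real.exp (D * ‖η‖ ^ q) * Real.exp (2 * Real.pi * inner ℝ (-w.fst) η) *
        Real.exp (D * ‖η‖ ^ q)) *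
        (Real.exp (-ε * ‖ξ - z.snd‖ ^ r) * Real.exp (-ε * ‖ξ - w.snd‖ ^ r)) := by ring
    _ = _ := by
        simp only [← Real.exp_add]
        rw [inner_neg_left, inner_sub_left]
        ring_nf

theorem exp_neg_norm_add_rpow_le {d : ℕ} {r ε R : ℝ} (hr : 0 ≤ r) (hε : 0 ≤ ε)
    (ξ v y : E d) (hv : ‖v‖ ≤ R) :
    Real.exp (-ε * ‖ξ + v - y‖ ^ r) ≤
      Real.exp (ε * (R + ‖y‖) ^ r) * Real.exp (-(ε / 2 ^ r) * ‖ξ‖ ^ r) := by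
  have h1 : ‖ξ‖ ≤ ‖ξ + v - y‖ + (R + ‖y‖) := by
    have h2 : ξ = (ξ + v - y) - (v - y) := by abel
    have h3 := norm_sub_le (ξ + v - y) (v - y)
    rw [← h2] at h3
    have := norm_sub_le v y
    linarith
  have hR : 0 ≤ R := (norm_nonneg v).trans hv
  have h4 := (Real.rpow_le_rpow (norm_nonneg ξ) h1 hr).trans
    (rpow_add_le_two_rpow_mul (norm_nonneg _) (by positivity) hr)
  rw [← Real.exp_add]
  refine Real.exp_le_exp.2 ?_
  have h5 : ε / 2 ^ r * ‖ξ‖ ^ r ≤ ε * (‖ξ + v - y‖ ^ r + (R + ‖y‖) ^ r) := by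
    rw [div_mul_eq_mul_div, div_le_iff₀ (by positivity)]
    calc ε * ‖ξ‖ ^ r ≤ ε * (2 ^ r * (‖ξ + v - y‖ ^ r + (R + ‖y‖) ^ r)) := by gcongr
      _ = _ := by ring
  linarith

/-- An entire symbol with controlled growth along `iℝ^d` has an almost diagonal Gabor matrix with
respect to Gelfand-Shilov windows. -/
theorem GelfandShilov.exists_gaborMatrix_bound {d : ℕ} {r q ν : ℝ} (hrq : r.HolderConjugate q)
    (hq : 2 ≤ q) (hν : 0 ≤ ν) (hνq : ν ≤ q) {g : 𝓢(E d, ℂ)}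
    (hg : GelfandShilov (1 / r) (1 / r) g) {CS DS : ℝ} (hCS : 0 ≤ CS) (hDS : 0 ≤ DS) :
    ∃ ε C : ℝ, 0 < ε ∧ 0 < C ∧ ∀ S : (Fin d → ℂ) → ℂ, Differentiable ℂ S →
      (∀ ξ η : E d, ‖S (cplx ξ η)‖ ≤ CS * Real.exp (DS * (1 + ‖η‖) ^ ν)) →
      ∀ z w : Phase d, Integrable (fun ξ => S (cplx ξ 0) * 𝓕 (timeFreqShift z g) ξ) ∧
        ‖∫ ξ, S (cplx ξ 0) * 𝓕 (timeFreqShift z g) ξ *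
          (starRingEnd ℂ) (𝓕 (timeFreqShift w g) ξ)‖ ≤ C * Real.exp (-ε * ‖w - z‖ ^ r) := by
  have hr := hrq.lt.le
  have hr0 : 0 ≤ r := hrq.nonneg
  have hq0 : 0 ≤ q := hrq.symm.nonneg
  obtain ⟨K, ε, D, hK, hε, hD, hb⟩ := hg.exists_fourierLaplace_bound hrq
  obtain ⟨δ, c, hδ, hcont⟩ := exists_contour (d := d) hrq hq hνq hDS
    (by positivity : 0 ≤ 2 * D)
  -- Decay of `g` itself serves only for continuity and holomorphy of the transforms. The
  -- quantitative bounds use `K`, `ε`, `D` from the Fourier side.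
  obtain ⟨K₀, B₀, ε₀, hK₀, -, hε₀, hg₀, -⟩ := hg.exists_decay hr
  obtain ⟨D₀, hD₀0, hD₀⟩ := young_scaled hrq (half_pos hε₀)
  have hgc₀ : ∀ x, ‖(starRingEnd ℂ) (g x)‖ ≤ K₀ * Real.exp (-ε₀ * ‖x‖ ^ r) := fun x => by
    rw [RCLike.norm_conj]; exact hg₀ x
  have hgcc : Continuous fun x => (starRingEnd ℂ) (g x) :=
    Complex.continuous_conj.comp g.continuous
  set I := ∫ x : E d, Real.exp (-(ε / 2) * ‖x‖ ^ r) with hI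
  have hI0 : 0 ≤ I := integral_nonneg fun x => (Real.exp_pos _).le
  have h2r : (0 : ℝ) < 2 ^ r := by positivity
  set κ := min δ (ε / 2 / 2 ^ r) with hκ
  have hκ0 : 0 < κ := lt_min hδ (by positivity)
  refine ⟨κ / 2 ^ r, CS * K ^ 2 * Real.exp c * I + 1, by positivity, by positivity,
    fun S hSd hS z w => ⟨?_, ?_⟩⟩
  · have hcx : Continuous fun ξ : E d => cplx ξ (0 : E d) :=
      continuous_cplx.comp (continuous_id.prodMk continuous_const)
    have hcx' : Continuous fun ξ : E d => cplx (ξ - z.snd) (0 : E d) :=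
      hcx.comp (continuous_id.sub continuous_const)
    have hmeas : Continuous fun ξ => S (cplx ξ 0) * 𝓕 (timeFreqShift z g) ξ := by
      simp only [fourier_timeFreqShift]
      exact (hSd.continuous.comp hcx).mul
        ((continuous_laplaceKernel.comp (hcx'.prodMk continuous_const)).mul
          ((continuous_fourierLaplace hr hq0 hε₀ hD₀ hK₀.le g.continuous hg₀).comp hcx'))
    refine (((integrable_exp_neg_norm_rpow (d := d) hr hε).comp_sub_right z.snd).const_mul
      (CS * Real.exp (DS * (1 + ‖(0 : E d)‖) ^ ν) * (K * Real.exp (D * ‖(0 : E d)‖ ^ q)))).mono'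
      hmeas.aestronglyMeasurable (Filter.Eventually.of_forall fun ξ => ?_)
    rw [norm_mul, fourier_timeFreqShift, norm_mul, norm_laplaceKernel, imVec_cplx, inner_zero_right,
      mul_zero, Real.exp_zero, one_mul]
    calc _ ≤ (CS * Real.exp (DS * (1 + ‖(0 : E d)‖) ^ ν)) *
          (K * Real.exp (-ε * ‖ξ - z.snd‖ ^ r) * Real.exp (D * ‖(0 : E d)‖ ^ q)) := by
          have h1 := hS ξ 0
          have h2 := hb (ξ - z.snd) 0
          gcongr
      _ = _ := by ring
  · obtain ⟨η, hη⟩ := hcont (w.fst - z.fst)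
    have hFb := norm_gaborIntegrand_le hCS hK.le hS hb z w
    have hFc : Continuous (gaborIntegrand S g z w) := by
      have h1 : Continuous fun ζ : Fin d → ℂ => ζ - cplx z.snd 0 := continuous_id.sub continuous_const
      have h2 : Continuous fun ζ : Fin d → ℂ => ζ - cplx w.snd 0 := continuous_id.sub continuous_const
      exact (hSd.continuous.mul ((continuous_laplaceKernel.comp (h1.prodMk continuous_const)).mul
        ((continuous_fourierLaplace hr hq0 hε₀ hD₀ hK₀.le g.continuous hg₀).comp h1))).mul
        ((continuous_laplaceKernel.comp (h2.prodMk continuous_const)).mul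
        ((continuous_fourierLaplace hr hq0 hε₀ hD₀ hK₀.le hgcc hgc₀).comp h2.neg))
    have hFd : ∀ ζ η : Fin d → ℂ, Differentiable ℂ fun a : ℂ => gaborIntegrand S g z w (ζ + a • η) := by
      intro ζ η
      have hk : ∀ (y : Fin d → ℂ) (x : E d),
          Differentiable ℂ fun a : ℂ => laplaceKernel (ζ + a • η - y) x := by
        intro y x
        simp only [laplaceKernel, Pi.add_apply, Pi.smul_apply, Pi.sub_apply, smul_eq_mul]
        fun_prop
      have h1 := differentiable_fourierLaplace_line hr hq0 hε₀ hD₀0.le hD₀ hK₀.le g.continuous hg₀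
        (ζ - cplx z.snd 0) η
      have h2 := differentiable_fourierLaplace_line hr hq0 hε₀ hD₀0.le hD₀ hK₀.le hgcc hgc₀
        (-(ζ - cplx w.snd 0)) (-η)
      have e1 : ∀ a : ℂ, ζ - cplx z.snd 0 + a • η = ζ + a • η - cplx z.snd 0 := fun a => by abel
      have e2 : ∀ a : ℂ, -(ζ - cplx w.snd 0) + a • (-η) = -(ζ + a • η - cplx w.snd 0) := fun a => by
        rw [smul_neg]; abel
      simp only [e1] at h1
      simp only [e2] at h2
      have h3 : Differentiable ℂ fun a : ℂ => S (ζ + a • η) := hSd.comp (by fun_prop)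
      exact (h3.mul ((hk _ _).mul h1)).mul ((hk _ _).mul h2)
    have hdom : ∀ R : ℝ, ∃ b : E d → ℝ, Integrable b ∧ ∀ ξ v η : E d, ‖v‖ ≤ R → ‖η‖ ≤ R →
        ‖gaborIntegrand S g z w (cplx (ξ + v) η)‖ ≤ b ξ := by
      intro R
      refine ⟨fun ξ => CS * K ^ 2 * Real.exp (DS * (1 + R) ^ ν + 2 * D * R ^ q +
        2 * Real.pi * (‖w.fst - z.fst‖ * R)) * (Real.exp (ε * (R + ‖z.snd‖) ^ r) *
          Real.exp (-(ε / 2 ^ r) * ‖ξ‖ ^ r)),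
        ((integrable_exp_neg_norm_rpow hr (by positivity)).const_mul _).const_mul _,
        fun ξ v η hv hη => (hFb (ξ + v) η).trans ?_⟩
      have h1 : Real.exp (-ε * ‖ξ + v - z.snd‖ ^ r - ε * ‖ξ + v - w.snd‖ ^ r) ≤
          Real.exp (ε * (R + ‖z.snd‖) ^ r) * Real.exp (-(ε / 2 ^ r) * ‖ξ‖ ^ r) := by
        refine le_trans (Real.exp_le_exp.2 ?_)
          (exp_neg_norm_add_rpow_le hr0 hε.le ξ v z.snd hv)
        have : 0 ≤ ε * ‖ξ + v - w.snd‖ ^ r := by positivity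
        linarith
      have h2 : DS * (1 + ‖η‖) ^ ν + 2 * D * ‖η‖ ^ q - 2 * Real.pi * inner ℝ (w.fst - z.fst) η ≤
          DS * (1 + R) ^ ν + 2 * D * R ^ q + 2 * Real.pi * (‖w.fst - z.fst‖ * R) := by
        have h3 : -inner ℝ (w.fst - z.fst) η ≤ ‖w.fst - z.fst‖ * R := by
          have h4 := neg_le_abs (inner ℝ (w.fst - z.fst) η)
          have h5 := abs_real_inner_le_norm (w.fst - z.fst) η
          have h6 : ‖w.fst - z.fst‖ * ‖η‖ ≤ ‖w.fst - z.fst‖ * R := by gcongr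
          linarith
        have h7 : DS * (1 + ‖η‖) ^ ν ≤ DS * (1 + R) ^ ν := by gcongr
        have h8 : 2 * D * ‖η‖ ^ q ≤ 2 * D * R ^ q := by gcongr
        have h9 := mul_le_mul_of_nonneg_left h3 (by positivity : 0 ≤ 2 * Real.pi)
        linarith
      beta_reduce
      gcongr
    simp only [← gaborIntegrand_real]
    rw [integral_cplx_zero_eq hFc hFd hdom η]
    -- The frequency decay is split in halves. One half gives decay in `w.snd - z.snd` through the
    -- triangle inequality; of the other, the part centred at `z.snd` keeps the integral convergent
    -- and the part at `w.snd` is dropped.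
    have hbound : ∀ ξ, ‖gaborIntegrand S g z w (cplx ξ η)‖ ≤
        CS * K ^ 2 * Real.exp (c - δ * ‖w.fst - z.fst‖ ^ r -
          ε / 2 / 2 ^ r * ‖w.snd - z.snd‖ ^ r) * Real.exp (-(ε / 2) * ‖ξ - z.snd‖ ^ r) := by
      intro ξ
      refine (hFb ξ η).trans ?_
      rw [mul_assoc (CS * K ^ 2), mul_assoc (CS * K ^ 2), ← Real.exp_add, ← Real.exp_add]
      gcongr CS * K ^ 2 * Real.exp ?_
      have h1 := norm_sub_rpow_le hr0 w.snd z.snd ξ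
      have h2 : ε / 2 / 2 ^ r * ‖w.snd - z.snd‖ ^ r ≤
          ε / 2 * (‖ξ - w.snd‖ ^ r + ‖ξ - z.snd‖ ^ r) := by
        rw [div_mul_eq_mul_div, div_le_iff₀ h2r, mul_assoc, mul_comm _ ((2 : ℝ) ^ r)]
        gcongr
      have h3 : 0 ≤ ε / 2 * ‖ξ - w.snd‖ ^ r := by positivity
      linarith
    have hint := ((integrable_exp_neg_norm_rpow (d := d) hr (half_pos hε)).comp_sub_right
      z.snd).const_mul (CS * K ^ 2 * Real.exp (c - δ * ‖w.fst - z.fst‖ ^ r -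
          ε / 2 / 2 ^ r * ‖w.snd - z.snd‖ ^ r))
    refine (norm_integral_le_of_norm_le hint (Filter.Eventually.of_forall hbound)).trans ?_
    rw [integral_const_mul,
      integral_sub_right_eq_self (fun x : E d => Real.exp (-(ε / 2) * ‖x‖ ^ r)) z.snd, ← hI]
    have hnorm : ‖w - z‖ ^ r ≤ 2 ^ r * (‖w.fst - z.fst‖ ^ r + ‖w.snd - z.snd‖ ^ r) := by
      have h1 : ‖w - z‖ ≤ ‖w.fst - z.fst‖ + ‖w.snd - z.snd‖ := by
        rw [WithLp.prod_norm_eq_of_L2, WithLp.sub_fst, WithLp.sub_snd]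
        refine Real.sqrt_le_iff.2 ⟨by positivity, ?_⟩
        nlinarith [norm_nonneg (w.fst - z.fst), norm_nonneg (w.snd - z.snd)]
      exact (Real.rpow_le_rpow (norm_nonneg _) h1 hr0).trans
        (rpow_add_le_two_rpow_mul (norm_nonneg _) (norm_nonneg _) hr0)
    have hexp : c - δ * ‖w.fst - z.fst‖ ^ r - ε / 2 / 2 ^ r * ‖w.snd - z.snd‖ ^ r ≤
        c + -(κ / 2 ^ r) * ‖w - z‖ ^ r := by
      have h1 : κ / 2 ^ r * ‖w - z‖ ^ r ≤ κ * (‖w.fst - z.fst‖ ^ r + ‖w.snd - z.snd‖ ^ r) := by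
        rw [div_mul_eq_mul_div, div_le_iff₀ h2r, mul_assoc, mul_comm _ ((2 : ℝ) ^ r)]
        gcongr
      have h2 : κ * ‖w.fst - z.fst‖ ^ r ≤ δ * ‖w.fst - z.fst‖ ^ r := by
        gcongr; exact min_le_left _ _
      have h3 : κ * ‖w.snd - z.snd‖ ^ r ≤ ε / 2 / 2 ^ r * ‖w.snd - z.snd‖ ^ r := by
        gcongr; exact min_le_right _ _
      linarith
    calc _ ≤ CS * K ^ 2 * Real.exp (c + -(κ / 2 ^ r) * ‖w - z‖ ^ r) * I := by gcongr
      _ = CS * K ^ 2 * Real.exp c * I * Real.exp (-(κ / 2 ^ r) * ‖w - z‖ ^ r) := by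
          rw [Real.exp_add]; ring
      _ ≤ _ := by
          gcongr
          linarith

/-! ### The propagator -/

/-- For every `t ≥ 0` the propagator symbol extends to an entire function on `ℂ^d` with growth
controlled by the Hadamard-Petrowsky condition, uniformly on bounded time intervals. -/
theorem EvolutionOperator.RefinedHadamardPetrowsky.exists_entire_extension {d : ℕ}
    {P : EvolutionOperator d} {ν : ℝ} (hP : P.RefinedHadamardPetrowsky ν) {T : ℝ} (hT : 0 ≤ T) :
    ∃ CS DS : ℝ, 0 ≤ CS ∧ 0 ≤ DS ∧ ∀ t ∈ Icc 0 T, ∃ S : (Fin d → ℂ) → ℂ, Differentiable ℂ S ∧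
      (∀ ξ : E d, P.propagatorSymbol t ξ = S (cplx ξ 0)) ∧
      ∀ ξ η : E d, ‖S (cplx ξ η)‖ ≤ CS * Real.exp (DS * (1 + ‖η‖) ^ ν) := by
  obtain ⟨C, hC, hroots⟩ := hP
  have heval : ∀ k, Differentiable ℂ fun ζ : Fin d → ℂ => MvPolynomial.eval ζ (P.a k) := fun k ζ =>
    (AnalyticOnNhd.eval_mvPolynomial (P.a k) ζ (mem_univ ζ)).differentiableAt
  obtain ⟨U, hU, hUd⟩ := exists_isClassicalSolution_differentiable P.m P.m_pos
    (fun ζ k => MvPolynomial.eval ζ (P.a k)) heval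
  refine ⟨∑ i ∈ Finset.range P.m, T ^ i, C * T, by positivity, by positivity, fun t ht =>
    ⟨fun ζ => U ζ 0 t, hUd t, fun ξ => ?_, fun ξ η => ?_⟩⟩
  · have h1 : cplx ξ 0 = fun j => (ξ j : ℂ) := by
      funext j; simp [cplx]
    rw [EvolutionOperator.propagatorSymbol, h1]
    exact (hU _).forwardFundamentalSolution_eq P.m_pos ht.1
  · have hpos : 0 ≤ C * (1 + ‖η‖) ^ ν := by positivity
    have h1 := (hU (cplx ξ η)).norm_le hT (M := C * (1 + ‖η‖) ^ ν) (fun l hl => ?_) t ht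
    · refine h1.trans ?_
      refine mul_le_mul_of_nonneg_left (Real.exp_le_exp.2 ?_) (by positivity)
      calc C * (1 + ‖η‖) ^ ν * t ≤ C * (1 + ‖η‖) ^ ν * T := by gcongr; exact ht.2
        _ = _ := by ring
    -- A root `l = iτ` has `τ = -il` and `Im τ = -Re l`, so the lower bound on `Im τ` becomes an
    -- upper bound on `Re l`.
    · have hI : Complex.I * (-Complex.I * l) = l := by
        rw [← mul_assoc, mul_neg, Complex.I_mul_I]; simp
      have h2 := hroots (-Complex.I * l) (cplx ξ η) (by rw [hI]; exact hl)
      have h3 : (WithLp.toLp 2 (fun j => (cplx ξ η j).im) : E d) = η := imVec_cplx ξ η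
      rw [h3] at h2
      simp at h2
      linarith

theorem one_lt_decayExponent {ν : ℝ} (hν : 1 ≤ ν) : 1 < decayExponent ν := by
  rw [decayExponent]
  split_ifs with h
  · norm_num
  · have : 1 < ν := lt_of_le_of_ne hν (Ne.symm h)
    refine lt_min (by norm_num) ?_
    rw [lt_div_iff₀ (by linarith)]
    linarith

theorem decayExponent_le_two (ν : ℝ) : decayExponent ν ≤ 2 := by
  rw [decayExponent]
  split_ifs
  · exact le_rfl
  · exact min_le_left _ _

/-- The exponent conjugate to `min(2, ν/(ν-1))` is `max(2, ν)`. This lemma and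
`le_conjExponent_decayExponent` are the two conditions needed by `exists_contour`. -/
theorem two_le_conjExponent_decayExponent {ν : ℝ} (hν : 1 ≤ ν) :
    2 ≤ (decayExponent ν).conjExponent := by
  have h1 := one_lt_decayExponent hν
  have h2 := decayExponent_le_two ν
  rw [Real.conjExponent, le_div_iff₀ (by linarith)]
  linarith

theorem le_conjExponent_decayExponent {ν : ℝ} (hν : 1 ≤ ν) :
    ν ≤ (decayExponent ν).conjExponent := by
  by_cases h : ν = 1
  · have := two_le_conjExponent_decayExponent hν
    linarith
  have hlt : 1 < ν := lt_of_le_of_ne hν (Ne.symm h)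
  have h1 := one_lt_decayExponent hν
  have h2 : decayExponent ν ≤ ν / (ν - 1) := by
    rw [decayExponent, if_neg h]; exact min_le_right _ _
  rw [le_div_iff₀ (by linarith)] at h2
  rw [Real.conjExponent, le_div_iff₀ (by linarith)]
  linarith

end GaborEvolution

theorem mainTheorem1 {d : ℕ} (P : GaborEvolution.EvolutionOperator d) (ν : ℝ) (hν : 1 ≤ ν)
    (hP : P.RefinedHadamardPetrowsky ν)
    (g : 𝓢(GaborEvolution.E d, ℂ))
    (hg : GaborEvolution.GelfandShilov (1 / GaborEvolution.decayExponent ν)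
      (1 / GaborEvolution.decayExponent ν) g)
    (B : Set ℝ) (hB : Bornology.IsBounded B) (hB0 : B ⊆ Set.Ici 0) :
    ∃ ε C : ℝ, 0 < ε ∧ 0 < C ∧ ∀ t ∈ B, ∀ z w : GaborEvolution.Phase d,
      -- the integrals that define the matrix entry converge absolutely
      Integrable (fun ξ => P.propagatorSymbol t ξ * 𝓕 (GaborEvolution.timeFreqShift z g) ξ) ∧
      Integrable (fun x => P.propagator t (GaborEvolution.timeFreqShift z g) x *
        (starRingEnd ℂ) (GaborEvolution.timeFreqShift w g x)) ∧
      ‖GaborEvolution.bracket (P.propagator t (GaborEvolution.timeFreqShift z g))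
          (GaborEvolution.timeFreqShift w g)‖ ≤
        C * Real.exp (-ε * ‖w - z‖ ^ GaborEvolution.decayExponent ν) := by
  open GaborEvolution in
  obtain ⟨T, hT⟩ := hB.subset_closedBall 0
  have hBT : B ⊆ Icc 0 |T| := fun t ht => by
    have h1 := hT ht
    rw [Metric.mem_closedBall, dist_zero_right, Real.norm_eq_abs] at h1
    exact ⟨hB0 ht, (le_abs_self t).trans (h1.trans (le_abs_self T))⟩
  obtain ⟨CS, DS, hCS, hDS, hS⟩ := hP.exists_entire_extension (abs_nonneg T)
  obtain ⟨ε, C, hε, hC, h⟩ := hg.exists_gaborMatrix_bound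
    (Real.HolderConjugate.conjExponent (one_lt_decayExponent hν))
    (two_le_conjExponent_decayExponent hν) (by linarith) (le_conjExponent_decayExponent hν) hCS hDS
  refine ⟨ε, C, hε, hC, fun t ht z w => ?_⟩
  obtain ⟨S, hSd, hSe, hSb⟩ := hS t (hBT ht)
  obtain ⟨hint, hbound⟩ := h S hSd hSb z w
  simp only [← hSe] at hint hbound
  refine ⟨hint, ?_, ?_⟩
  -- The propagated function is the inverse transform of an integrable function, hence bounded and
  -- continuous; the shifted window is integrable.
  · exact (Complex.conjLIE.integrable_comp_iff.2 (integrable_timeFreqShift w g)).bdd_mul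
      (continuous_fourierInv hint).aestronglyMeasurable
      (Filter.Eventually.of_forall fun x => norm_fourierInv_le _ x)
  · rw [EvolutionOperator.propagator, fourierMultiplier,
      bracket_fourierInv hint (integrable_timeFreqShift w g)]
    exact hbound
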